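/- Fix $a\in(-1,1)$ and let $\sigma_a(t)=t$ for $t\ge 0$, $\sigma_a(t)=at$ for $t<0$. A fully connected network of depth $L\ge 1$ with parameters $\theta=(W_1,b_1,\dots,W_L,b_L)$ (arbitrary finite hidden widths) computes $\alpha_0(x)=x$, $\tilde\alpha_\ell(x)=W_\ell\alpha_{\ell-1}(x)+b_\ell$, $\alpha_\ell(x)=\sigma_a(\tilde\alpha_\ell(x))$ (entrywise), and $f_\theta=\tilde\alpha_L$. For $\Omega\subset\mathbb{R}^d$ and $f:\mathbb{R}^{d}\to\mathbb{R}^{m}$ let $R(f;\Omega,L)\in[0,\infty]$ be the infimum of $\|\theta\|^2=\sum_\ell(\|W_\ell\|_F^2+\|b_\ell\|^2)$ over the depth-$L$ networks with $f_\theta=f$ on $\Omega$, and let $$R^{(0)}(f;\Omega)=\lim_{L\to\infty}\frac{R(f;\Omega,L)}{L},\qquad R^{(1)}(f;\Omega)=\lim_{L\to\infty}\bigl(R(f;\Omega,L)-L\,R^{(0)}(f;\Omega)\bigr);$$ "$R^{(1)}(f;\Omega)=r$" means that both limits exist, the first being finite, and that the second equals $r$. We say that $\Omega$ has a tangent space at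 $x\in\Omega$ if the set of all limits of $c_n(y_n-x)$ with $c_n\in\mathbb{R}$, $y_n\in\Omega$, $y_n\to x$ is a linear subspace, which is then denoted $T_x\Omega$. The Jacobian rank $\mathrm{Rank}_J(f;\Omega)$ is the maximum of $\mathrm{Rank}\,Jf(x)_{|T_x\Omega}$ over the $x\in\Omega$ where $\Omega$ has a tangent space and $f$ is differentiable along $\Omega$, so $\mathrm{Rank}_J(\mathrm{id};\Omega)=\max_x\dim T_x\Omega$. The Bottleneck rank $\mathrm{Rank}_{BN}(f;\Omega)$ is the smallest $r$ such that $f=h\circ g$ on $\Omega$ for some continuous finite piecewise linear functions $g:\mathbb{R}^d\to\mathbb{R}^r$ and $h:\mathbb{R}^r\to\mathbb{R}^{m}$ (each piece being affine). **Proposition.** Let $\Omega\subset\mathbb{R}^d$ be a bounded set with $\mathrm{Rank}_J(\mathrm{id};\Omega)=\mathrm{Rank}_{BN}(\mathrm{id};\Omega)=k$, such that the points $x\in\Omega$ with $\dim T_x\Omega=k$ are dense in $\Omega$. Then $R^{(1)}(\mathrm{id};\Omega)=0$ if and only if $\Omega$ is $k$-planar (its linear span has dimension $k$) and completely positive (for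 some $m$ there is a linear isometric map $O:\mathrm{span}\,\Omega\to\mathbb{R}^m$ with $O\Omega\subset\mathbb{R}^m_{+}$, the nonnegative orthant). -/

import Mathlib

open Filter Topology
open scoped ENNReal NNReal

noncomputable section

namespace DeepNet

/-- The homogeneous nonlinearity `σ_a` (ReLU for `a = 0`). -/
def sigma (a t : ℝ) : ℝ := if 0 ≤ t then t else a * t

/-- Parameters `θ = (W₁, b₁, …, W_L, b_L)` of a fully connected network with input dimension
`din`, depth `L ≥ 1` (the number of weight layers), output dimension `dout` and arbitrary finite
hidden widths; the arguments of `Net` after `din` are the depth and the output dimension.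
There is no network of depth `0`. -/
inductive Net (din : ℕ) : ℕ → ℕ → Type
  | first {n : ℕ} (W : Matrix (Fin n) (Fin din) ℝ) (b : Fin n → ℝ) : Net din 1 n
  | layer {L n m : ℕ} (N : Net din L n) (W : Matrix (Fin m) (Fin n) ℝ) (b : Fin m → ℝ) :
      Net din (L + 1) m

/-- The network function: the pre-activation of the last layer. -/
def Net.eval (a : ℝ) {din : ℕ} : {L dout : ℕ} → Net din L dout → (Fin din → ℝ) → Fin dout → ℝ
  | _, _, .first W b, x => W.mulVec x + b
  | _, _, .layer N W b, x => W.mulVec (fun i => sigma a (N.eval a x i)) + b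

/-- The squared parameter norm `‖θ‖²` (weights and biases). -/
def Net.normSq {din : ℕ} : {L dout : ℕ} → Net din L dout → ℝ
  | _, _, .first W b => (∑ i, ∑ j, W i j ^ 2) + ∑ i, b i ^ 2
  | _, _, .layer N W b => N.normSq + ((∑ i, ∑ j, W i j ^ 2) + ∑ i, b i ^ 2)

/-- The representation cost `R(f; Ω, L)`: the infimum of `‖θ‖²` over all depth `L` networks, of
any finite widths, that agree with `f` on `Ω`; it is `∞` if there is no such network. -/
def repCost (a : ℝ) {d m : ℕ} (f : EuclideanSpace ℝ (Fin d) → EuclideanSpace ℝ (Fin m))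
    (Ω : Set (EuclideanSpace ℝ (Fin d))) (L : ℕ) : ℝ≥0∞ :=
  ⨅ (N : Net d L m) (_ : ∀ x ∈ Ω, ∀ i, N.eval a x.ofLp i = f x i), ENNReal.ofReal N.normSq

/-- `R⁽⁰⁾(f; Ω) = r`, that is, `R(f; Ω, L) / L → r` as `L → ∞`. -/
def HasLeadingTerm (a : ℝ) {d m : ℕ} (f : EuclideanSpace ℝ (Fin d) → EuclideanSpace ℝ (Fin m))
    (Ω : Set (EuclideanSpace ℝ (Fin d))) (r : ℝ≥0) : Prop :=
  Tendsto (fun L : ℕ => repCost a f Ω L / (L : ℝ≥0∞)) atTop (𝓝 (r : ℝ≥0∞))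

/-- `R⁽¹⁾(f; Ω) = r`, that is, `R⁽⁰⁾(f; Ω)` exists and
`R(f; Ω, L) - L R⁽⁰⁾(f; Ω) → r` as `L → ∞`. -/
def HasFirstCorrection (a : ℝ) {d m : ℕ}
    (f : EuclideanSpace ℝ (Fin d) → EuclideanSpace ℝ (Fin m))
    (Ω : Set (EuclideanSpace ℝ (Fin d))) (r : EReal) : Prop :=
  ∃ r₀ : ℝ≥0, HasLeadingTerm a f Ω r₀ ∧
    Tendsto (fun L : ℕ => (repCost a f Ω L : EReal) - (((L : ℝ) * (r₀ : ℝ) : ℝ) : EReal))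
      atTop (𝓝 r)

/-- Finite piecewise linear functions: continuous functions that coincide at every point with one
of finitely many affine maps. -/
def IsFPLF {n m : ℕ} (f : EuclideanSpace ℝ (Fin n) → EuclideanSpace ℝ (Fin m)) : Prop :=
  Continuous f ∧ ∃ s : Set (EuclideanSpace ℝ (Fin n) →ᵃ[ℝ] EuclideanSpace ℝ (Fin m)),
    s.Finite ∧ ∀ x, ∃ A ∈ s, f x = A x

/-- `Rank_BN(f; Ω) = k`: the smallest inner dimension of a factorization of `f` on `Ω` through
finite piecewise linear functions. -/
def IsBottleneckRank {d m : ℕ} (f : EuclideanSpace ℝ (Fin d) → EuclideanSpace ℝ (Fin m))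
    (Ω : Set (EuclideanSpace ℝ (Fin d))) (k : ℕ) : Prop :=
  IsLeast {r : ℕ | ∃ (g : EuclideanSpace ℝ (Fin d) → EuclideanSpace ℝ (Fin r))
    (h : EuclideanSpace ℝ (Fin r) → EuclideanSpace ℝ (Fin m)),
    IsFPLF g ∧ IsFPLF h ∧ ∀ x ∈ Ω, f x = h (g x)} k

/-- `Ω` has a tangent space at `x`, namely the linear subspace `T`: the limits of
`c n • (y n - x)` with real `c n` (of either sign) and `y n ∈ Ω` tending to `x` are exactly the
vectors of `T`. For a submanifold, with or without boundary, `T` is the usual tangent space. -/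
def HasTangentSpace {d : ℕ} (Ω : Set (EuclideanSpace ℝ (Fin d))) (x : EuclideanSpace ℝ (Fin d))
    (T : Submodule ℝ (EuclideanSpace ℝ (Fin d))) : Prop :=
  tangentConeAt ℝ Ω x = (T : Set (EuclideanSpace ℝ (Fin d)))

/-- `Rank_J(f; Ω) = k`: the maximum of the rank of the Jacobian of `f` restricted to `T_x Ω`, over
the points `x ∈ Ω` at which `Ω` has a tangent space and `f` is differentiable along `Ω`. -/
def IsJacobianRank {d m : ℕ} (f : EuclideanSpace ℝ (Fin d) → EuclideanSpace ℝ (Fin m))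
    (Ω : Set (EuclideanSpace ℝ (Fin d))) (k : ℕ) : Prop :=
  IsGreatest {r : ℕ | ∃ x ∈ Ω, ∃ T : Submodule ℝ (EuclideanSpace ℝ (Fin d)),
    ∃ J : EuclideanSpace ℝ (Fin d) →L[ℝ] EuclideanSpace ℝ (Fin m),
      HasTangentSpace Ω x T ∧ HasFDerivWithinAt f J Ω x ∧
      Module.finrank ℝ (T.map (J : EuclideanSpace ℝ (Fin d) →ₗ[ℝ] EuclideanSpace ℝ (Fin m))) = r} k

/-- `Ω` is `k`-planar: its linear span is `k`-dimensional. -/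
def IsPlanar {d : ℕ} (Ω : Set (EuclideanSpace ℝ (Fin d))) (k : ℕ) : Prop :=
  Module.finrank ℝ (Submodule.span ℝ Ω) = k

/-- `Ω` is completely positive: an isometric linear map (on the span of `Ω`) embeds it into the
nonnegative orthant of some `ℝ^m`. -/
def IsCompletelyPositive {d : ℕ} (Ω : Set (EuclideanSpace ℝ (Fin d))) : Prop :=
  ∃ (m : ℕ) (O : Submodule.span ℝ Ω →ₗᵢ[ℝ] EuclideanSpace ℝ (Fin m)),
    ∀ (x : EuclideanSpace ℝ (Fin d)) (hx : x ∈ Ω) (i : Fin m),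
      0 ≤ O ⟨x, Submodule.subset_span hx⟩ i

end DeepNet

end

/-! Let `Q` be an orthonormal frame of a `k`-dimensional tangent space `T` at a point `x` of `Ω`. A
network that is the identity on `Ω` has an activation pattern valid at `x` whose Jacobian `J`
satisfies `J Q = Q`. Follow the Gram determinant of the frame through the layers. Every eigenvalue
`λ` of a Gram matrix satisfies `λ ≤ exp (λ - 1)`, so a weight matrix `W` multiplies the determinant
by at most `exp (‖W‖² - k)` (`gramDet_mul_le`), and activations, having slopes in `[-1, 1]`, do not
increase it. The excess `‖θ‖² - k L - log det` is therefore nonnegative and never decreases from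
layer to layer; since the final determinant is `1`, the cost is at least `k L`. Conversely, a
factorization through `ℝ^k` with identity layers inserted at the bottleneck costs `k L + O(1)`.
Hence the leading coefficient is `k`, and a zero correction provides networks of arbitrarily small
excess.

Small excess has two consequences. Biases, and the parts of the weights that miss the propagated
frame, are small, which forces `x ∈ T` (`exists_eval_near_range`). Moreover the first weight matrix,
common to all points, is nearly isometric on each tangent space, nearly zero on its complement, and
sends each point nearly into the orthant (`nearIsometry_of_small_excess`). The width may grow as the
error tends to `0`, but Carathéodory's theorem for Gram matrices (`exists_few_rows`) bounds the
number of rows. Compactness then gives one `O` such that `Oᵀ O` is the orthogonal projection onto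
every tangent space: these spaces coincide, contain `Ω` by density, and `O` embeds `Ω` in the
orthant.

Conversely, if `C` is the matrix of an isometric embedding into the orthant, in the coordinates of a
frame `Q` of the span, the layers `C Qᵀ, C Cᵀ, …, C Cᵀ, Q Cᵀ` compute the identity at squared norm
`k` each, which attains the lower bound. -/

noncomputable section

namespace DeepNet
open Matrix

/-! ### Gram determinants, Frobenius norms and their basic inequality. -/

section

variable {m n p q : Type*} [Fintype m] [Fintype n] [Fintype p] [Fintype q]

/-- The squared Euclidean norm of a vector. -/
def sqNorm (v : n → ℝ) : ℝ := ∑ i, v i ^ 2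

/-- The squared Frobenius norm of a matrix. -/
def frobSq (A : Matrix m n ℝ) : ℝ := ∑ i, ∑ j, A i j ^ 2

lemma sqNorm_nonneg (v : n → ℝ) : 0 ≤ sqNorm v := Finset.sum_nonneg fun _ _ => sq_nonneg _

lemma frobSq_nonneg (A : Matrix m n ℝ) : 0 ≤ frobSq A :=
  Finset.sum_nonneg fun _ _ => Finset.sum_nonneg fun _ _ => sq_nonneg _

lemma sqNorm_eq_norm_sq (v : n → ℝ) : sqNorm v = ‖WithLp.toLp 2 v‖ ^ 2 := by
  simp [sqNorm, EuclideanSpace.norm_sq_eq]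

lemma sqNorm_eq_dotProduct (v : n → ℝ) : sqNorm v = v ⬝ᵥ v := by
  simp [sqNorm, dotProduct, sq]

lemma frobSq_eq_trace (A : Matrix m n ℝ) : frobSq A = (Aᵀ * A).trace := by
  simp only [frobSq, trace, diag_apply, mul_apply, transpose_apply, sq]
  exact Finset.sum_comm

lemma frobSq_eq_trace' (A : Matrix m n ℝ) : frobSq A = (A * Aᵀ).trace := by
  rw [frobSq_eq_trace, trace_mul_comm]

lemma sqNorm_mulVec_le (A : Matrix m n ℝ) (v : n → ℝ) :
    sqNorm (A *ᵥ v) ≤ frobSq A * sqNorm v := by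
  unfold frobSq sqNorm
  rw [Finset.sum_mul]
  refine Finset.sum_le_sum fun i _ => ?_
  exact Finset.sum_mul_sq_le_sq_mul_sq _ _ _

lemma sqNorm_mulVec_of_orthonormal [DecidableEq q] {Q : Matrix n q ℝ} (hQ : Qᵀ * Q = 1) (v : q → ℝ) :
    sqNorm (Q *ᵥ v) = sqNorm v := by
  rw [sqNorm_eq_dotProduct, sqNorm_eq_dotProduct, dotProduct_mulVec, vecMul_mulVec, ← mulVec_transpose]
  simp [hQ]

lemma frobSq_diagonal_mul_le [DecidableEq n] {s : n → ℝ} (hs : ∀ i, s i ^ 2 ≤ 1)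
    (U : Matrix n q ℝ) : frobSq (diagonal s * U) ≤ frobSq U := by
  refine Finset.sum_le_sum fun i _ => Finset.sum_le_sum fun j _ => ?_
  rw [diagonal_mul, mul_pow]
  exact mul_le_of_le_one_left (sq_nonneg _) (hs i)

/-- The Gram determinant of the columns of a matrix. -/
def gramDet [DecidableEq q] (U : Matrix n q ℝ) : ℝ := (Uᵀ * U).det

lemma posSemidef_transpose_mul_self (U : Matrix n q ℝ) : (Uᵀ * U).PosSemidef := by
  simpa using posSemidef_conjTranspose_mul_self U

section
variable [DecidableEq q]

lemma gramDet_nonneg (U : Matrix n q ℝ) : 0 ≤ gramDet U :=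
  (posSemidef_transpose_mul_self U).det_nonneg

lemma det_le_exp_trace {M : Matrix q q ℝ} (hM : M.PosSemidef) :
    M.det ≤ Real.exp (M.trace - Fintype.card q) := by
  rw [hM.1.det_eq_prod_eigenvalues, hM.1.trace_eq_sum_eigenvalues]
  have : ∑ i, ((hM.1.eigenvalues i : ℝ)) - (Fintype.card q : ℝ)
      = ∑ i, (hM.1.eigenvalues i - 1) := by simp
  simp only [RCLike.ofReal_real_eq_id, id]
  rw [this, Real.exp_sum]
  refine Finset.prod_le_prod (fun i _ => hM.eigenvalues_nonneg i) fun i _ => ?_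
  linarith [Real.add_one_le_exp (hM.1.eigenvalues i - 1)]

/-- The equality case of `det_le_exp_trace`: `λ < exp (λ - 1)` unless `λ = 1`, so every eigenvalue
is `1`. This turns a vanishing excess into an exact isometry. -/
lemma eq_one_of_exp_trace_le_det {M : Matrix q q ℝ} (hM : M.PosSemidef)
    (h : Real.exp (M.trace - Fintype.card q) ≤ M.det) : M = 1 := by
  have key : ∀ i, hM.1.eigenvalues i = 1 := by
    by_contra! hne
    obtain ⟨i, hi⟩ := hne
    refine absurd h (not_le.mpr ?_)
    have hpos : 0 < M.det := (Real.exp_pos _).trans_le h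
    rw [hM.1.det_eq_prod_eigenvalues] at hpos ⊢
    rw [hM.1.trace_eq_sum_eigenvalues]
    have : ∑ i, ((hM.1.eigenvalues i : ℝ)) - (Fintype.card q : ℝ)
        = ∑ i, (hM.1.eigenvalues i - 1) := by simp
    simp only [RCLike.ofReal_real_eq_id, id] at hpos ⊢
    rw [this, Real.exp_sum]
    refine Finset.prod_lt_prod (fun j _ => ?_) (fun j _ => ?_) ⟨i, Finset.mem_univ _, ?_⟩
    · refine lt_of_le_of_ne (hM.eigenvalues_nonneg j) fun h0 => hpos.ne' ?_
      exact Finset.prod_eq_zero (Finset.mem_univ j) h0.symm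
    · linarith [Real.add_one_le_exp (hM.1.eigenvalues j - 1)]
    · linarith [Real.add_one_lt_exp (sub_ne_zero.mpr hi)]
  have hs := hM.1.spectral_theorem
  have hd : (RCLike.ofReal ∘ hM.1.eigenvalues : q → ℝ) = fun _ => 1 := by
    ext i; simp [key i]
  rw [hd, diagonal_one, map_one] at hs
  exact hs

lemma gramDet_le_exp_frobSq (U : Matrix n q ℝ) :
    gramDet U ≤ Real.exp (frobSq U - Fintype.card q) := by
  rw [frobSq_eq_trace]
  exact det_le_exp_trace (posSemidef_transpose_mul_self U)

lemma gramDet_mul_right (U : Matrix n q ℝ) (B : Matrix q q ℝ) :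
    gramDet (U * B) = B.det ^ 2 * gramDet U := by
  simp only [gramDet, transpose_mul, Matrix.mul_assoc]
  rw [det_mul, ← Matrix.mul_assoc, det_mul, det_transpose]
  ring

lemma gramDet_of_orthonormal {Q : Matrix n q ℝ} (hQ : Qᵀ * Q = 1) : gramDet Q = 1 := by
  simp [gramDet, hQ]

lemma frobSq_of_orthonormal {Q : Matrix n q ℝ} (hQ : Qᵀ * Q = 1) : frobSq Q = Fintype.card q := by
  simp [frobSq_eq_trace, hQ]

lemma gramDet_ne_zero_of_mul (W : Matrix m n ℝ) (U : Matrix n q ℝ) (h : gramDet (W * U) ≠ 0) :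
    gramDet U ≠ 0 := by
  intro h0
  obtain ⟨v, hv, hv0⟩ := Matrix.exists_mulVec_eq_zero_iff.mpr h0
  refine h (Matrix.exists_mulVec_eq_zero_iff.mp ⟨v, hv, ?_⟩)
  have hU : U *ᵥ v = 0 := by
    have h1 : sqNorm (U *ᵥ v) = 0 := by
      rw [sqNorm_eq_dotProduct, dotProduct_mulVec, vecMul_mulVec, ← dotProduct_mulVec]
      simp [hv0]
    rw [sqNorm_eq_norm_sq] at h1
    have h2 := pow_eq_zero_iff (two_ne_zero) |>.mp h1
    simpa using h2
  rw [← mulVec_mulVec, ← mulVec_mulVec, hU]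
  simp

-- Factor the positive definite Gram matrix as `Bᴴ B` and take `R = B⁻¹`. The frame reaching a layer
-- can thus be replaced by an orthonormal one with the same range, at a known change of determinant.
open scoped MatrixOrder Matrix.Norms.L2Operator in
lemma exists_orthonormal_factor {U : Matrix n q ℝ} (hU : gramDet U ≠ 0) :
    ∃ (Q : Matrix n q ℝ) (R : Matrix q q ℝ), Qᵀ * Q = 1 ∧ Q = U * R ∧ R.det ^ 2 * gramDet U = 1 := by
  have hpd : (Uᵀ * U).PosDef :=
    (posSemidef_transpose_mul_self U).posDef_iff_det_ne_zero.mpr hU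
  obtain ⟨B, hB, hUB⟩ := CStarAlgebra.isStrictlyPositive_iff_eq_star_mul_self.mp
    hpd.isStrictlyPositive
  rw [star_eq_conjTranspose] at hUB
  have hBd : IsUnit B.det := (Matrix.isUnit_iff_isUnit_det B).mp hB
  have hQ : (U * B⁻¹)ᵀ * (U * B⁻¹) = 1 := by
    rw [transpose_mul, Matrix.mul_assoc, ← Matrix.mul_assoc Uᵀ, hUB, conjTranspose_eq_transpose_of_trivial,
      Matrix.mul_assoc, Matrix.mul_nonsing_inv _ hBd, Matrix.mul_one, ← transpose_mul,
      Matrix.mul_nonsing_inv _ hBd, transpose_one]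
  exact ⟨_, _, hQ, rfl, by rw [← gramDet_mul_right, gramDet_of_orthonormal hQ]⟩

/-- Pythagoras, row by row: `Q Qᵀ` is the orthogonal projection onto the range of `Q`. -/
lemma frobSq_eq_add_of_orthonormal (W : Matrix m n ℝ) {Q : Matrix n q ℝ} (hQ : Qᵀ * Q = 1) :
    frobSq W = frobSq (W * Q) + frobSq (W - W * Q * Qᵀ) := by
  have h : ∀ X : Matrix q m ℝ, Qᵀ * (Q * X) = X := fun X => by
    rw [← Matrix.mul_assoc, hQ, Matrix.one_mul]
  simp only [frobSq_eq_trace', transpose_sub, transpose_mul, transpose_transpose, Matrix.sub_mul,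
    Matrix.mul_sub, trace_sub, Matrix.mul_assoc, h]
  ring

/-- Applying `W` changes the Gram determinant of `U` by a factor at most `exp (‖W‖² - k)`, with a
loss controlled by the part of `W` that does not see the range of `U`. -/
lemma gramDet_mul_le (W : Matrix m n ℝ) {U : Matrix n q ℝ} {Q : Matrix n q ℝ} {R : Matrix q q ℝ}
    (hQ : Qᵀ * Q = 1) (hQR : Q = U * R) (hR : R.det ^ 2 * gramDet U = 1) :
    gramDet (W * U) * Real.exp (frobSq (W - W * Q * Qᵀ))
      ≤ gramDet U * Real.exp (frobSq W - Fintype.card q) := by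
  have h1 : gramDet (W * Q) = R.det ^ 2 * gramDet (W * U) := by
    rw [hQR, ← Matrix.mul_assoc, gramDet_mul_right]
  have h2 : gramDet (W * U) = gramDet U * gramDet (W * Q) := by
    rw [h1]; linear_combination - gramDet (W * U) * hR
  rw [h2, mul_assoc]
  refine mul_le_mul_of_nonneg_left ?_ (gramDet_nonneg U)
  have h3 := gramDet_le_exp_frobSq (W * Q)
  calc _ ≤ Real.exp (frobSq (W * Q) - Fintype.card q) * Real.exp (frobSq (W - W * Q * Qᵀ)) := by
        gcongr
    _ = _ := by rw [← Real.exp_add, frobSq_eq_add_of_orthonormal W hQ]; ring_nf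

/-- On an orthonormal frame the contraction leaves a Frobenius norm squared of at most the number of
columns, so the exponential bound is at most `1`. -/
lemma gramDet_diagonal_mul_le [DecidableEq n] {s : n → ℝ} (hs : ∀ i, s i ^ 2 ≤ 1)
    (U : Matrix n q ℝ) : gramDet (diagonal s * U) ≤ gramDet U := by
  by_cases hU : gramDet U = 0
  · by_contra! h
    exact gramDet_ne_zero_of_mul (diagonal s) U (hU ▸ h).ne' hU
  obtain ⟨Q, R, hQ, hQR, hR⟩ := exists_orthonormal_factor hU
  have h1 : gramDet (diagonal s * Q) = R.det ^ 2 * gramDet (diagonal s * U) := by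
    rw [hQR, ← Matrix.mul_assoc, gramDet_mul_right]
  have h2 : gramDet (diagonal s * U) = gramDet U * gramDet (diagonal s * Q) := by
    rw [h1]; linear_combination - gramDet (diagonal s * U) * hR
  rw [h2]
  refine mul_le_of_le_one_right (gramDet_nonneg U) ((gramDet_le_exp_frobSq _).trans ?_)
  rw [Real.exp_le_one_iff]
  have := frobSq_diagonal_mul_le hs Q
  rw [frobSq_of_orthonormal hQ] at this
  linarith

end

end

/-! ### Activation patterns and Jacobians along tangent spaces. -/

section

/-- The slope of `sigma a` on the nonnegative (`true`) or nonpositive (`false`) half line. -/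
def slope (a : ℝ) {n : ℕ} (s : Fin n → Bool) (i : Fin n) : ℝ := if s i then 1 else a

lemma slope_sq_le_one {a : ℝ} (ha : -1 < a ∧ a < 1) {n : ℕ} (s : Fin n → Bool) (i : Fin n) :
    slope a s i ^ 2 ≤ 1 := by
  unfold slope
  split_ifs
  · simp
  · nlinarith [ha.1, ha.2]

lemma continuous_sigma (a : ℝ) : Continuous (sigma a) := by
  unfold sigma
  exact Continuous.if_le continuous_id (by fun_prop) continuous_const continuous_id
    (fun t ht => by simp [← ht])

/-- The sign condition saying that the activation signs `s` are correct for the vector `v`. -/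
def SignsMatch {n : ℕ} (s : Fin n → Bool) (v : Fin n → ℝ) : Prop :=
  ∀ i, (s i = true → 0 ≤ v i) ∧ (s i = false → v i ≤ 0)

lemma SignsMatch.sigma_eq {a : ℝ} {n : ℕ} {s : Fin n → Bool} {v : Fin n → ℝ}
    (h : SignsMatch s v) : (fun i => sigma a (v i)) = diagonal (slope a s) *ᵥ v := by
  ext i
  rw [mulVec_diagonal]
  obtain ⟨h1, h2⟩ := h i
  unfold sigma slope
  cases hs : s i
  · have := h2 hs
    by_cases h0 : 0 ≤ v i
    · simp [le_antisymm this h0]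
    · simp [h0]
  · simp [h1 hs]

lemma exists_signsMatch {n : ℕ} (v : Fin n → ℝ) : ∃ s, SignsMatch s v := by
  classical
  refine ⟨fun i => decide (0 ≤ v i), fun i => ?_⟩
  simp only [decide_eq_true_eq, decide_eq_false_iff_not, not_le, imp_self, true_and]
  exact le_of_lt

lemma isClosed_signsMatch {n : ℕ} (s : Fin n → Bool) : IsClosed {v | SignsMatch s v} := by
  simp only [SignsMatch, Set.ofPred_forall, Set.ofPred_and]
  refine isClosed_iInter fun i => IsClosed.inter ?_ ?_
  · exact isClosed_iInter fun _ => isClosed_le continuous_const (continuous_apply i)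
  · exact isClosed_iInter fun _ => isClosed_le (continuous_apply i) continuous_const

/-- The activation patterns of a network: the signs of all hidden preactivations. -/
def Net.Pattern {d : ℕ} : {L n : ℕ} → Net d L n → Type
  | _, _, .first _ _ => Unit
  | _, _, .layer (n := n) N _ _ => N.Pattern × (Fin n → Bool)

lemma Net.finite_pattern {d : ℕ} {L n : ℕ} (N : Net d L n) : Finite N.Pattern := by
  induction N with
  | first W b => exact inferInstanceAs (Finite Unit)
  | @layer L n m N W b ih => exact inferInstanceAs (Finite (N.Pattern × (Fin n → Bool)))

/-- The Jacobian of the network on an activation pattern. -/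
def Net.jac (a : ℝ) {d : ℕ} : {L n : ℕ} → (N : Net d L n) → N.Pattern → Matrix (Fin n) (Fin d) ℝ
  | _, _, .first W _, _ => W
  | _, _, .layer N W _, p => W * (diagonal (slope a p.2) * N.jac a p.1)

/-- The input `x` has activation pattern `p` (zero preactivations may be given either sign). -/
def Net.Valid (a : ℝ) {d : ℕ} : {L n : ℕ} → (N : Net d L n) → N.Pattern → (Fin d → ℝ) → Prop
  | _, _, .first _ _, _, _ => True
  | _, _, .layer N _ _, p, x => N.Valid a p.1 x ∧ SignsMatch p.2 (N.eval a x)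

variable {a : ℝ} {d : ℕ}

lemma Net.continuous_eval {L n : ℕ} (N : Net d L n) : Continuous (N.eval a) := by
  induction N with
  | first W b => exact (Continuous.matrix_mulVec continuous_const continuous_id).add continuous_const
  | layer N W b ih =>
    refine Continuous.add ?_ continuous_const
    refine Continuous.matrix_mulVec continuous_const ?_
    exact continuous_pi fun i => (continuous_sigma a).comp ((continuous_apply i).comp ih)

lemma Net.exists_valid {L n : ℕ} (N : Net d L n) (x : Fin d → ℝ) : ∃ p, N.Valid a p x := by
  induction N with
  | first W b => exact ⟨(), trivial⟩
  | layer N W b ih =>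
    obtain ⟨p, hp⟩ := ih
    obtain ⟨s, hs⟩ := exists_signsMatch (N.eval a x)
    exact ⟨(p, s), hp, hs⟩

lemma Net.isClosed_valid {L n : ℕ} (N : Net d L n) (p : N.Pattern) :
    IsClosed {x | N.Valid a p x} := by
  induction N with
  | first W b => exact isClosed_univ
  | layer N W b ih => exact (ih p.1).inter ((isClosed_signsMatch p.2).preimage N.continuous_eval)

/-- With a common pattern every activation acts on both inputs by the same diagonal matrix, so the
network is affine on the closed cell of `p`. -/
lemma Net.eval_sub_eval {L n : ℕ} (N : Net d L n) {p : N.Pattern} {x y : Fin d → ℝ}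
    (hx : N.Valid a p x) (hy : N.Valid a p y) :
    N.eval a y - N.eval a x = N.jac a p *ᵥ (y - x) := by
  induction N with
  | first W b => simp [Net.eval, Net.jac, mulVec_sub]
  | layer N W b ih =>
    have := ih hx.1 hy.1
    simp only [Net.eval, Net.jac]
    rw [hx.2.sigma_eq, hy.2.sigma_eq, ← mulVec_mulVec, ← mulVec_mulVec, ← this, mulVec_sub,
      mulVec_sub]
    abel

/-- If a network is the identity on `Ω`, then one of its Jacobians at a point of `Ω` is the
identity on the tangent space. -/
lemma Net.exists_valid_jac_eq {L : ℕ} (N : Net d L d) {Ω : Set (EuclideanSpace ℝ (Fin d))}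
    (hN : ∀ x ∈ Ω, ∀ i, N.eval a x.ofLp i = x i) {x : EuclideanSpace ℝ (Fin d)} (hx : x ∈ Ω)
    {T : Submodule ℝ (EuclideanSpace ℝ (Fin d))} (hT : HasTangentSpace Ω x T) :
    ∃ p, N.Valid a p x.ofLp ∧ ∀ v ∈ T, N.jac a p *ᵥ v.ofLp = v.ofLp := by
  have hfin := N.finite_pattern
  have hN' : ∀ y ∈ Ω, N.eval a y.ofLp = y.ofLp := fun y hy => funext (hN y hy)
  have step : ∀ v ∈ T, ∃ p, N.Valid a p x.ofLp ∧ N.jac a p *ᵥ v.ofLp = v.ofLp := by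
    intro v hv
    have hv' : v ∈ tangentConeAt ℝ Ω x := by rw [hT]; exact hv
    obtain ⟨α, l, hl, c, u, hu0, huΩ, hcu⟩ := exists_fun_of_mem_tangentConeAt hv'
    -- Pigeonhole: one of the finitely many patterns recurs frequently along the approximating
    -- points. Its cell is closed, so it contains `x`, and on it the network is affine and fixes
    -- these points.
    choose P hP using fun n : α => N.exists_valid (a := a) (x + u n).ofLp
    have hfreq : ∃ p, ∃ᶠ n in l, P n = p := by
      by_contra! hcon
      obtain ⟨n, hn⟩ := (eventually_all.mpr hcon).exists
      exact hn (P n) rfl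
    obtain ⟨p, hp⟩ := hfreq
    have hne : (l ⊓ 𝓟 {n | P n = p}).NeBot := frequently_iff_neBot.mp hp
    have hev : ∀ᶠ n in l ⊓ 𝓟 {n | P n = p}, P n = p := by
      simp [eventually_inf_principal]
    have hlim : Tendsto (fun n => (x + u n).ofLp) (l ⊓ 𝓟 {n | P n = p}) (𝓝 x.ofLp) := by
      have h1 : Tendsto (fun n => x + u n) (l ⊓ 𝓟 {n | P n = p}) (𝓝 x) := by
        simpa using (hu0.mono_left inf_le_left).const_add x
      exact ((PiLp.continuous_ofLp 2 _).tendsto x).comp h1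
    have hval : N.Valid a p x.ofLp := by
      refine (N.isClosed_valid p).mem_of_tendsto hlim ?_
      filter_upwards [hev] with n hn
      exact hn ▸ hP n
    refine ⟨p, hval, ?_⟩
    have hcu' : Tendsto (fun n => (c n • u n).ofLp) (l ⊓ 𝓟 {n | P n = p}) (𝓝 v.ofLp) :=
      ((PiLp.continuous_ofLp 2 _).tendsto v).comp (hcu.mono_left inf_le_left)
    have hcont : Continuous fun w : Fin d → ℝ => N.jac a p *ᵥ w :=
      Continuous.matrix_mulVec continuous_const continuous_id
    refine tendsto_nhds_unique ((hcont.tendsto _).comp hcu') (hcu'.congr' ?_)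
    filter_upwards [hev, huΩ.filter_mono inf_le_left] with n hn hnΩ
    have h1 := N.eval_sub_eval hval (hn ▸ hP n : N.Valid a p (x + u n).ofLp)
    rw [hN' _ hnΩ, hN' _ hx] at h1
    simp only [WithLp.ofLp_add, add_sub_cancel_left] at h1
    simp only [Function.comp, WithLp.ofLp_smul, mulVec_smul, ← h1]
  let S : {p // N.Valid a p x.ofLp} → Submodule ℝ T := fun p =>
    LinearMap.ker (((N.jac a p.1).mulVecLin ∘ₗ (WithLp.linearEquiv 2 ℝ (Fin d → ℝ)).toLinearMap
      - (WithLp.linearEquiv 2 ℝ (Fin d → ℝ)).toLinearMap) ∘ₗ T.subtype)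
  have hS : ∀ p v, v ∈ S p ↔ N.jac a p.1 *ᵥ (v : EuclideanSpace ℝ (Fin d)).ofLp
      = (v : EuclideanSpace ℝ (Fin d)).ofLp := fun p v => by
    simp [S, sub_eq_zero]
  -- The pattern found above depends on `v`. But finitely many subspaces cover `T`, and a real
  -- vector space is not a finite union of proper subspaces, so one pattern serves all of `T`.
  obtain ⟨p, hp⟩ := Subspace.exists_eq_top_of_iUnion_eq_univ (p := S) (by
    ext v
    simp only [Set.mem_iUnion, SetLike.mem_coe, Set.mem_univ, iff_true]
    obtain ⟨p, hp, h⟩ := step v v.2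
    exact ⟨⟨p, hp⟩, (hS _ _).mpr h⟩)
  exact ⟨p.1, p.2, fun v hv => (hS p ⟨v, hv⟩).mp (hp ▸ Submodule.mem_top)⟩

end

/-! ### The excess and its accumulation through the layers. -/

section

variable {a : ℝ} {d k : ℕ}

/-- The amount by which `‖θ‖²` exceeds `k L` plus the logarithm of the Gram determinant of the
Jacobian on a `k`-dimensional frame. -/
def Net.excess (a : ℝ) {L n : ℕ} (N : Net d L n) (p : N.Pattern) (Q : Matrix (Fin d) (Fin k) ℝ) : ℝ :=
  N.normSq - L * k - Real.log (gramDet (N.jac a p * Q))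

lemma log_gramDet_mul_le {m n : ℕ} (W : Matrix (Fin m) (Fin n) ℝ) {U Q : Matrix (Fin n) (Fin k) ℝ}
    {R : Matrix (Fin k) (Fin k) ℝ} (hQ : Qᵀ * Q = 1) (hQR : Q = U * R)
    (hR : R.det ^ 2 * gramDet U = 1) (h : gramDet (W * U) ≠ 0) :
    Real.log (gramDet (W * U)) + frobSq (W - W * Q * Qᵀ)
      ≤ Real.log (gramDet U) + (frobSq W - k) := by
  have hU := gramDet_ne_zero_of_mul W U h
  have h1 := Real.log_le_log
    (mul_pos ((gramDet_nonneg _).lt_of_ne' h) (Real.exp_pos _)) (gramDet_mul_le W hQ hQR hR)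
  rwa [Real.log_mul h (Real.exp_pos _).ne', Real.log_mul hU (Real.exp_pos _).ne', Real.log_exp,
    Real.log_exp, Fintype.card_fin] at h1

lemma gramDet_ne_zero_of_layer {L n m : ℕ} {N : Net d L n} {W : Matrix (Fin m) (Fin n) ℝ}
    {b : Fin m → ℝ} {p : N.Pattern × (Fin n → Bool)} {Q : Matrix (Fin d) (Fin k) ℝ}
    (h : gramDet ((Net.layer N W b).jac a p * Q) ≠ 0) :
    gramDet (diagonal (slope a p.2) * (N.jac a p.1 * Q)) ≠ 0 ∧ gramDet (N.jac a p.1 * Q) ≠ 0 := by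
  have h' : gramDet (W * (diagonal (slope a p.2) * (N.jac a p.1 * Q))) ≠ 0 := by
    simpa [Net.jac, Matrix.mul_assoc] using h
  have h1 := gramDet_ne_zero_of_mul _ _ h'
  exact ⟨h1, gramDet_ne_zero_of_mul _ _ h1⟩

/-- The excess before the last linear map, including the last activation. -/
def Net.excessAct (a : ℝ) {L n : ℕ} (N : Net d L n) (p : N.Pattern × (Fin n → Bool))
    (Q : Matrix (Fin d) (Fin k) ℝ) : ℝ :=
  N.normSq - L * k - Real.log (gramDet (diagonal (slope a p.2) * (N.jac a p.1 * Q)))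

lemma Net.excess_le_excessAct (ha : -1 < a ∧ a < 1) {L n : ℕ} (N : Net d L n)
    (p : N.Pattern × (Fin n → Bool)) {Q : Matrix (Fin d) (Fin k) ℝ}
    (h : gramDet (diagonal (slope a p.2) * (N.jac a p.1 * Q)) ≠ 0) :
    N.excess a p.1 Q ≤ N.excessAct a p Q := by
  have := Real.log_le_log ((gramDet_nonneg _).lt_of_ne' h)
    (gramDet_diagonal_mul_le (slope_sq_le_one ha p.2) (N.jac a p.1 * Q))
  unfold Net.excess Net.excessAct
  linarith

/-- The bias and the part of `W` vanishing on the propagated frame add to the norm without adding to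
the determinant, so both are charged in full to the excess. -/
lemma Net.excess_layer {L n m : ℕ} {N : Net d L n} {W : Matrix (Fin m) (Fin n) ℝ}
    {b : Fin m → ℝ} {p : N.Pattern × (Fin n → Bool)} {Q : Matrix (Fin d) (Fin k) ℝ}
    (h : gramDet ((Net.layer N W b).jac a p * Q) ≠ 0) :
    ∃ (Q' : Matrix (Fin n) (Fin k) ℝ) (R : Matrix (Fin k) (Fin k) ℝ), Q'ᵀ * Q' = 1 ∧
      Q' = diagonal (slope a p.2) * (N.jac a p.1 * Q) * R ∧
      N.excessAct a p Q + frobSq (W - W * Q' * Q'ᵀ) + sqNorm b ≤ (Net.layer N W b).excess a p Q := by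
  obtain ⟨Q', R, hQ, hQR, hR⟩ := exists_orthonormal_factor (gramDet_ne_zero_of_layer h).1
  refine ⟨Q', R, hQ, hQR, ?_⟩
  have hJ : (Net.layer N W b).jac a p * Q = W * (diagonal (slope a p.2) * (N.jac a p.1 * Q)) := by
    simp [Net.jac, Matrix.mul_assoc]
  have h1 := log_gramDet_mul_le W hQ hQR hR (hJ ▸ h)
  unfold Net.excess Net.excessAct
  rw [hJ]
  change _ ≤ N.normSq + (frobSq W + sqNorm b) - _ - _
  push_cast
  linarith

lemma Net.excess_first {n : ℕ} {W : Matrix (Fin n) (Fin d) ℝ} {b : Fin n → ℝ}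
    {p : (Net.first W b).Pattern} {Q : Matrix (Fin d) (Fin k) ℝ} (hQ : Qᵀ * Q = 1)
    (h : gramDet ((Net.first W b).jac a p * Q) ≠ 0) :
    frobSq (W - W * Q * Qᵀ) + sqNorm b ≤ (Net.first W b).excess a p Q := by
  have h1 := log_gramDet_mul_le W (U := Q) (R := 1) hQ (by simp)
    (by simp [gramDet_of_orthonormal hQ]) h
  rw [gramDet_of_orthonormal hQ, Real.log_one] at h1
  change _ ≤ (frobSq W + sqNorm b) - ((1 : ℕ) : ℝ) * k - Real.log (gramDet (W * Q))
  push_cast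
  linarith

lemma Net.excess_nonneg (ha : -1 < a ∧ a < 1) {L n : ℕ} (N : Net d L n) (p : N.Pattern)
    {Q : Matrix (Fin d) (Fin k) ℝ} (hQ : Qᵀ * Q = 1) (h : gramDet (N.jac a p * Q) ≠ 0) :
    0 ≤ N.excess a p Q := by
  induction N with
  | first W b =>
    exact (add_nonneg (frobSq_nonneg _) (sqNorm_nonneg _)).trans (Net.excess_first hQ h)
  | layer N W b ih =>
    obtain ⟨Q', R, -, -, h1⟩ := Net.excess_layer h
    have h2 := gramDet_ne_zero_of_layer h
    have h3 := ih p.1 h2.2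
    have h4 := N.excess_le_excessAct ha p h2.1
    linarith [frobSq_nonneg (W - W * Q' * Q'ᵀ), sqNorm_nonneg b]

lemma norm_mulVec_add_le {m n : ℕ} {A : Matrix (Fin m) (Fin n) ℝ} {b : Fin m → ℝ} {η : ℝ}
    (hη : 0 ≤ η) (hA : frobSq A ≤ η ^ 2) (hb : sqNorm b ≤ η ^ 2) (r : Fin n → ℝ) :
    ‖WithLp.toLp 2 (A *ᵥ r + b)‖ ≤ η * (‖WithLp.toLp 2 r‖ + 1) := by
  have h1 : ‖WithLp.toLp 2 (A *ᵥ r)‖ ≤ η * ‖WithLp.toLp 2 r‖ := by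
    refine abs_le_of_sq_le_sq' ?_ (by positivity) |>.2
    rw [← sqNorm_eq_norm_sq, mul_pow, ← sqNorm_eq_norm_sq]
    exact (sqNorm_mulVec_le A r).trans (mul_le_mul_of_nonneg_right hA (sqNorm_nonneg r))
  have h2 : ‖WithLp.toLp 2 b‖ ≤ η := by
    refine abs_le_of_sq_le_sq' ?_ hη |>.2
    rwa [← sqNorm_eq_norm_sq]
  rw [WithLp.toLp_add]
  linarith [norm_add_le (WithLp.toLp 2 (A *ᵥ r)) (WithLp.toLp 2 b)]

/-- If the excess is small, the output at `x` is close to the linear image of the frame. -/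
lemma Net.exists_eval_near_range (ha : -1 < a ∧ a < 1) {L n : ℕ} (N : Net d L n) (p : N.Pattern)
    {Q : Matrix (Fin d) (Fin k) ℝ} (hQ : Qᵀ * Q = 1) (h : gramDet (N.jac a p * Q) ≠ 0)
    {x : Fin d → ℝ} (hx : N.Valid a p x) {η : ℝ} (hη : 0 ≤ η) (hη' : η ≤ 1 / 2)
    (he : N.excess a p Q ≤ η ^ 2) :
    ∃ z, ‖WithLp.toLp 2 (N.eval a x - (N.jac a p * Q) *ᵥ z)‖ ≤ η * (‖WithLp.toLp 2 x‖ + 2) := by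
  induction N with
  | first W b =>
    refine ⟨Qᵀ *ᵥ x, ?_⟩
    have h1 := Net.excess_first hQ h
    have h2 := norm_mulVec_add_le (A := W - W * Q * Qᵀ) (b := b) hη
      (by linarith [sqNorm_nonneg b]) (by linarith [frobSq_nonneg (W - W * Q * Qᵀ)]) x
    have h3 : (Net.first W b).eval a x - ((Net.first W b).jac a p * Q) *ᵥ (Qᵀ *ᵥ x)
        = (W - W * Q * Qᵀ) *ᵥ x + b := by
      simp only [Net.eval, Net.jac, mulVec_mulVec, sub_mulVec]
      abel
    rw [h3]
    exact h2.trans (by gcongr; norm_num)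
  | @layer L n m N W b ih =>
    obtain ⟨Q', R, hQ', hQR, h1⟩ := Net.excess_layer h
    have h2 := gramDet_ne_zero_of_layer h
    have h3 := N.excess_le_excessAct ha p h2.1
    have h4 := N.excess_nonneg ha p.1 hQ h2.2
    have hf := frobSq_nonneg (W - W * Q' * Q'ᵀ)
    have hb := sqNorm_nonneg b
    obtain ⟨z, hz⟩ := ih p.1 h2.2 hx.1 (by linarith)
    set r := diagonal (slope a p.2) *ᵥ (N.eval a x - (N.jac a p.1 * Q) *ᵥ z) with hr
    have hrn : ‖WithLp.toLp 2 r‖ ≤ η * (‖WithLp.toLp 2 x‖ + 2) := by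
      refine le_trans ?_ hz
      refine abs_le_of_sq_le_sq' ?_ (by positivity) |>.2
      rw [← sqNorm_eq_norm_sq, ← sqNorm_eq_norm_sq]
      refine Finset.sum_le_sum fun i _ => ?_
      rw [hr, mulVec_diagonal, mul_pow]
      exact mul_le_of_le_one_left (sq_nonneg _) (slope_sq_le_one ha _ i)
    -- The component of the residual `r` in the range of `Q'` is absorbed into the coefficients;
    -- only its complement, which `W` nearly kills, and the bias remain.
    refine ⟨z + R *ᵥ (Q'ᵀ *ᵥ r), ?_⟩
    have h5 : (Net.layer N W b).eval a x
        - ((Net.layer N W b).jac a p * Q) *ᵥ (z + R *ᵥ (Q'ᵀ *ᵥ r))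
        = (W - W * Q' * Q'ᵀ) *ᵥ r + b := by
      have e1 : (Net.layer N W b).eval a x = W *ᵥ (diagonal (slope a p.2) *ᵥ N.eval a x) + b := by
        simp only [Net.eval]; rw [hx.2.sigma_eq]
      have e2 : (Net.layer N W b).jac a p * Q
          = W * (diagonal (slope a p.2) * (N.jac a p.1 * Q)) := by
        simp [Net.jac, Matrix.mul_assoc]
      have e3 : (W * (diagonal (slope a p.2) * (N.jac a p.1 * Q))) *ᵥ (R *ᵥ (Q'ᵀ *ᵥ r))
          = (W * Q' * Q'ᵀ) *ᵥ r := by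
        rw [mulVec_mulVec, mulVec_mulVec, Matrix.mul_assoc W, ← hQR, ]
      rw [e1, e2, mulVec_add, e3, sub_mulVec]
      have e4 : W *ᵥ r = W *ᵥ (diagonal (slope a p.2) *ᵥ N.eval a x)
          - (W * (diagonal (slope a p.2) * (N.jac a p.1 * Q))) *ᵥ z := by
        rw [hr, mulVec_sub, mulVec_sub]
        simp only [mulVec_mulVec]
      rw [e4]
      abel
    rw [h5]
    have h6 := norm_mulVec_add_le (A := W - W * Q' * Q'ᵀ) (b := b) hη
      (by linarith) (by linarith) r
    -- As `η ≤ 1/2`, the inherited bound gives `‖r‖ + 1 ≤ ‖x‖ / 2 + 2`. The error thus reproduces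
    -- itself instead of growing with the depth.
    refine h6.trans (mul_le_mul_of_nonneg_left ?_ hη)
    have := norm_nonneg (WithLp.toLp 2 x)
    nlinarith

/-- The excess is at least the excess collected in the first layer. -/
lemma Net.exists_first_layer (ha : -1 < a ∧ a < 1) {L n : ℕ} (N : Net d L n) (hL : 2 ≤ L) :
    ∃ (n₁ : ℕ) (W : Matrix (Fin n₁) (Fin d) ℝ) (b : Fin n₁ → ℝ),
      ∀ (p : N.Pattern) (x : Fin d → ℝ), N.Valid a p x →
      ∀ Q : Matrix (Fin d) (Fin k) ℝ, gramDet (N.jac a p * Q) ≠ 0 →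
      ∃ s, SignsMatch s (W *ᵥ x + b) ∧ gramDet (diagonal (slope a s) * (W * Q)) ≠ 0 ∧
        frobSq W + sqNorm b - k - Real.log (gramDet (diagonal (slope a s) * (W * Q)))
          ≤ N.excess a p Q := by
  induction N with
  | first W b => omega
  | layer N W b ih =>
    cases N with
    | first W₁ b₁ =>
      refine ⟨_, W₁, b₁, fun p x hx Q h => ⟨p.2, hx.2, (gramDet_ne_zero_of_layer h).1, ?_⟩⟩
      obtain ⟨Q', R, -, -, h1⟩ := Net.excess_layer h
      refine le_trans (le_of_eq ?_) (le_trans (a := (Net.first W₁ b₁).excessAct a p Q)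
        le_rfl (by linarith [frobSq_nonneg (W - W * Q' * Q'ᵀ), sqNorm_nonneg b]))
      simp [Net.excessAct, Net.jac, Net.normSq, frobSq, sqNorm]
    | layer N₁ W₁ b₁ =>
      obtain ⟨n₁, V, c, hV⟩ := ih (by cases N₁ <;> omega)
      refine ⟨n₁, V, c, fun p x hx Q h => ?_⟩
      have h2 := gramDet_ne_zero_of_layer h
      obtain ⟨s, hs, h0, h1⟩ := hV p.1 x hx.1 Q h2.2
      refine ⟨s, hs, h0, h1.trans ?_⟩
      obtain ⟨Q', R, -, -, h3⟩ := Net.excess_layer h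
      have h4 := Net.excess_le_excessAct ha _ p h2.1
      linarith [frobSq_nonneg (W - W * Q' * Q'ᵀ), sqNorm_nonneg b]

end

/-! ### From first layers of small excess to an exact isometry. -/

section

variable {a : ℝ} {d k : ℕ}

/-- `W` is, up to an error `ε`, an isometry on the range of `Q` that vanishes on its complement and
maps `x` to the nonnegative orthant. -/
def NearIsometry {n : ℕ} (W : Matrix (Fin n) (Fin d) ℝ) (Q : Matrix (Fin d) (Fin k) ℝ)
    (x : Fin d → ℝ) (ε : ℝ) : Prop :=
  frobSq W - frobSq (W * Q) ≤ ε ∧ Real.exp (frobSq (W * Q) - k - ε) ≤ gramDet (W * Q) ∧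
    ∑ i, min ((W *ᵥ x) i) 0 ^ 2 ≤ ε

lemma NearIsometry.mono {n : ℕ} {W : Matrix (Fin n) (Fin d) ℝ} {Q : Matrix (Fin d) (Fin k) ℝ}
    {x : Fin d → ℝ} {ε δ : ℝ} (h : NearIsometry W Q x ε) (hδ : ε ≤ δ) : NearIsometry W Q x δ :=
  ⟨h.1.trans hδ, le_trans (Real.exp_le_exp.mpr (by linarith)) h.2.1, h.2.2.trans hδ⟩

lemma frobSq_eq_frobSq_diagonal_mul_add {n : ℕ} (s : Fin n → ℝ) (U : Matrix (Fin n) (Fin k) ℝ) :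
    frobSq U = frobSq (diagonal s * U) + ∑ i, (1 - s i ^ 2) * sqNorm (U i) := by
  unfold frobSq sqNorm
  rw [← Finset.sum_add_distrib]
  refine Finset.sum_congr rfl fun i _ => ?_
  rw [Finset.mul_sum, ← Finset.sum_add_distrib]
  refine Finset.sum_congr rfl fun j _ => ?_
  rw [diagonal_mul]
  ring

/-- A first layer of small excess is nearly an isometry. -/
lemma nearIsometry_of_small_excess (ha : -1 < a ∧ a < 1) {n : ℕ} {W : Matrix (Fin n) (Fin d) ℝ}
    {b : Fin n → ℝ} {s : Fin n → Bool} {Q : Matrix (Fin d) (Fin k) ℝ} (hQ : Qᵀ * Q = 1)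
    {z : Fin k → ℝ} (hs : SignsMatch s (W *ᵥ (Q *ᵥ z) + b))
    (h0 : gramDet (diagonal (slope a s) * (W * Q)) ≠ 0) {ε : ℝ}
    (he : frobSq W + sqNorm b - k - Real.log (gramDet (diagonal (slope a s) * (W * Q))) ≤ ε) :
    NearIsometry W Q (Q *ᵥ z) (ε * (1 + sqNorm z / (1 - a ^ 2))) := by
  have ha2 : 0 < 1 - a ^ 2 := by nlinarith [ha.1, ha.2]
  have hpos := (gramDet_nonneg _).lt_of_ne' h0
  have hgd := gramDet_diagonal_mul_le (slope_sq_le_one ha s) (W * Q)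
  have hlog : Real.log (gramDet (diagonal (slope a s) * (W * Q)))
      ≤ frobSq (diagonal (slope a s) * (W * Q)) - k := by
    have := Real.log_le_log hpos (gramDet_le_exp_frobSq (diagonal (slope a s) * (W * Q)))
    simpa using this
  have hfr := frobSq_eq_frobSq_diagonal_mul_add (slope a s) (W * Q)
  have hWQ := frobSq_eq_add_of_orthonormal W hQ
  have hf0 := frobSq_nonneg (W - W * Q * Qᵀ)
  have hb0 := sqNorm_nonneg b
  have hterm : ∀ i, 0 ≤ (1 - slope a s i ^ 2) * sqNorm ((W * Q) i) := fun i =>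
    mul_nonneg (by linarith [slope_sq_le_one ha s i]) (sqNorm_nonneg _)
  have hsum0 := Finset.sum_nonneg fun i (_ : i ∈ Finset.univ) => hterm i
  have hε : 0 ≤ ε := by linarith
  have hz : 0 ≤ sqNorm z / (1 - a ^ 2) := div_nonneg (sqNorm_nonneg z) ha2.le
  have hεle : ε ≤ ε * (1 + sqNorm z / (1 - a ^ 2)) := by nlinarith [mul_nonneg hε hz]
  have hcond : NearIsometry W Q (Q *ᵥ z) (ε * (1 + sqNorm z / (1 - a ^ 2))) ↔
      ∑ i, min ((W *ᵥ (Q *ᵥ z)) i) 0 ^ 2 ≤ ε * (1 + sqNorm z / (1 - a ^ 2)) := by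
    refine ⟨fun h => h.2.2, fun h => ⟨by linarith, le_trans ?_ hgd, h⟩⟩
    rw [← Real.le_log_iff_exp_le hpos]
    linarith
  rw [hcond]
  -- An active unit has `W x + b ≥ 0`, so its negative part is at most `|b|`. An inactive unit loses
  -- the fraction `1 - a²` of its row of `W Q`, which the excess controls; this is where `|a| < 1`
  -- is strict.
  have key : ∀ i, min ((W *ᵥ (Q *ᵥ z)) i) 0 ^ 2
      ≤ b i ^ 2 + (1 - slope a s i ^ 2) * sqNorm ((W * Q) i) * (sqNorm z / (1 - a ^ 2)) := by
    intro i
    have hi := hs i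
    simp only [Pi.add_apply] at hi
    cases hsi : s i
    · have hsl : slope a s i = a := by simp [slope, hsi]
      have h1 : min ((W *ᵥ (Q *ᵥ z)) i) 0 ^ 2 ≤ (W *ᵥ (Q *ᵥ z)) i ^ 2 := by
        rcases le_total ((W *ᵥ (Q *ᵥ z)) i) 0 with h | h
        · rw [min_eq_left h]
        · rw [min_eq_right h, zero_pow two_ne_zero]; exact sq_nonneg _
      have h2 : (W *ᵥ (Q *ᵥ z)) i ^ 2 ≤ sqNorm ((W * Q) i) * sqNorm z := by
        rw [mulVec_mulVec]
        exact Finset.sum_mul_sq_le_sq_mul_sq Finset.univ ((W * Q) i) z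
      have h3 : (1 - slope a s i ^ 2) * sqNorm ((W * Q) i) * (sqNorm z / (1 - a ^ 2))
          = sqNorm ((W * Q) i) * sqNorm z := by
        rw [hsl]; field_simp
      rw [h3]
      linarith [sq_nonneg (b i)]
    · have h1 := hi.1 hsi
      have h2 : min ((W *ᵥ (Q *ᵥ z)) i) 0 ^ 2 ≤ b i ^ 2 := by
        rcases le_total ((W *ᵥ (Q *ᵥ z)) i) 0 with h | h
        · rw [min_eq_left h]; nlinarith
        · rw [min_eq_right h, zero_pow two_ne_zero]; exact sq_nonneg _
      linarith [mul_nonneg (hterm i) hz]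
  refine (Finset.sum_le_sum fun i _ => key i).trans ?_
  rw [Finset.sum_add_distrib, ← Finset.sum_mul]
  have h5 : ∑ i, b i ^ 2 ≤ ε := by change sqNorm b ≤ ε; linarith
  have h6 : ∑ i, (1 - slope a s i ^ 2) * sqNorm ((W * Q) i) ≤ ε := by linarith
  have := mul_le_mul_of_nonneg_right h6 hz
  linarith

/-- Apply the determinant bound to half the Gram matrix: with `2 ^ k ≤ exp k` it gives `det ≤ exp
(‖U‖² / 2)`, which is incompatible with the hypothesis for large `‖U‖`. This gives the boundedness
needed for compactness. -/
lemma frobSq_le_of_exp_le_gramDet {n : ℕ} {U : Matrix (Fin n) (Fin k) ℝ} {ε : ℝ}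
    (h : Real.exp (frobSq U - k - ε) ≤ gramDet U) : frobSq U ≤ 2 * (k + ε) := by
  have h1 : gramDet U = 2 ^ k * ((1 / 2 : ℝ) • (Uᵀ * U)).det := by
    rw [det_smul, gramDet, Fintype.card_fin, ← mul_assoc, ← mul_pow]
    norm_num
  have h2 := det_le_exp_trace ((posSemidef_transpose_mul_self U).smul (by norm_num : (0 : ℝ) ≤ 1 / 2))
  rw [trace_smul, ← frobSq_eq_trace, Fintype.card_fin, smul_eq_mul] at h2
  have h3 : (2 : ℝ) ^ k ≤ Real.exp k := by
    rw [← Real.exp_one_rpow, Real.rpow_natCast]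
    exact pow_le_pow_left₀ (by norm_num) (by linarith [Real.add_one_le_exp (1 : ℝ)]) k
  have h4 : Real.exp (frobSq U - k - ε) ≤ Real.exp (k + (1 / 2 * frobSq U - k)) := by
    rw [Real.exp_add]
    refine h.trans (h1.le.trans ?_)
    exact mul_le_mul h3 h2 ((posSemidef_transpose_mul_self U).smul (by norm_num)).det_nonneg
      (Real.exp_pos _).le
  have := Real.exp_le_exp.mp h4
  linarith

/-- Carathéodory's theorem for Gram matrices: the number of rows can be reduced to a bound that
depends on the number of columns only, preserving the Gram matrix and one homogeneous quantity. -/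
lemma exists_few_rows {n : ℕ} (W : Matrix (Fin n) (Fin d) ℝ) (ψ : (Fin d → ℝ) → ℝ)
    (hψ : ∀ (c : ℝ) (u), 0 ≤ c → ψ (c • u) = c ^ 2 * ψ u) :
    ∃ O : Matrix (Fin (d * d + 2)) (Fin d) ℝ, Oᵀ * O = Wᵀ * W ∧ ∑ i, ψ (O i) = ∑ i, ψ (W i) := by
  let φ : (Fin d → ℝ) → Matrix (Fin d) (Fin d) ℝ × ℝ := fun u => (vecMulVec u u, ψ u)
  have hφ : ∀ (c : ℝ) (u), 0 ≤ c → φ (√c • u) = c • φ u := by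
    intro c u hc
    simp only [φ, hψ _ _ (Real.sqrt_nonneg c), Real.sq_sqrt hc, smul_vecMulVec, vecMulVec_smul,
      smul_smul, Real.mul_self_sqrt hc, Prod.smul_mk, smul_eq_mul]
  have hφ0 : φ 0 = 0 := by
    have := hφ 0 0 le_rfl
    simpa using this
  have hgram : ∀ {l : ℕ} (V : Matrix (Fin l) (Fin d) ℝ),
      ∑ i, φ (V i) = (Vᵀ * V, ∑ i, ψ (V i)) := by
    intro l V
    refine Prod.ext ?_ (by simp [φ, Prod.snd_sum])
    ext i j
    simp [φ, Prod.fst_sum, Matrix.sum_apply, mul_apply, vecMulVec_apply]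
  have hmem : ∑ i, φ (W i) ∈ convexHull ℝ (Set.range φ) := by
    rcases Nat.eq_zero_or_pos n with rfl | hn
    · simpa using subset_convexHull ℝ _ (Set.mem_range.mpr ⟨0, hφ0⟩)
    · have hn' : (0 : ℝ) < n := by exact_mod_cast hn
      -- Quadratic homogeneity of `φ` turns the sum over rows into a convex combination of values of
      -- `φ`.
      have : ∑ i, φ (W i) = ∑ i : Fin n, ((n : ℝ)⁻¹) • φ (√(n : ℝ) • W i) := by
        refine Finset.sum_congr rfl fun i _ => ?_
        rw [hφ _ _ hn'.le, smul_smul, inv_mul_cancel₀ hn'.ne', one_smul]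
      rw [this]
      refine (convex_convexHull ℝ _).sum_mem (fun _ _ => by positivity) ?_ fun i _ =>
        subset_convexHull ℝ _ ⟨_, rfl⟩
      simp [hn'.ne']
  obtain ⟨ι, _, z, w, hz, hai, hw, -, hsum⟩ := eq_pos_convex_span_of_mem_convexHull hmem
  choose u hu using fun i => hz ⟨i, rfl⟩
  -- The ambient space has dimension `d * d + 1`: the Gram matrix and one extra scalar.
  have hcard : Fintype.card ι ≤ d * d + 2 := by
    refine hai.card_le_finrank_succ.trans ?_
    have h1 := Submodule.finrank_le (vectorSpan ℝ (Set.range z))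
    have h2 : Module.finrank ℝ (Matrix (Fin d) (Fin d) ℝ × ℝ) = d * d + 1 := by
      rw [Module.finrank_prod, Module.finrank_matrix]
      simp
    omega
  obtain ⟨e⟩ : Nonempty (ι ↪ Fin (d * d + 2)) :=
    Function.Embedding.nonempty_of_card_le (by simpa using hcard)
  let O : Matrix (Fin (d * d + 2)) (Fin d) ℝ := Function.extend e (fun i => √(w i) • u i) 0
  have hO : ∑ i, φ (O i) = ∑ i, φ (W i) := by
    rw [← hsum]
    symm
    refine Fintype.sum_of_injective e e.injective _ _ (fun j hj => ?_) fun i => ?_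
    · have : O j = 0 := Function.extend_apply' _ _ _ (by simpa using hj)
      rw [this, hφ0]
    · have : O (e i) = √(w i) • u i := e.injective.extend_apply _ _ _
      rw [this, hφ _ _ (hw i).le, hu]
  rw [hgram, hgram, Prod.mk.injEq] at hO
  exact ⟨O, hO⟩

lemma frobSq_mul_of_gram_eq {n m : ℕ} {W : Matrix (Fin n) (Fin d) ℝ} {O : Matrix (Fin m) (Fin d) ℝ}
    (h : Oᵀ * O = Wᵀ * W) (Q : Matrix (Fin d) (Fin k) ℝ) :
    frobSq (O * Q) = frobSq (W * Q) ∧ gramDet (O * Q) = gramDet (W * Q) := by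
  have : (O * Q)ᵀ * (O * Q) = (W * Q)ᵀ * (W * Q) := by
    simp only [transpose_mul, Matrix.mul_assoc]
    rw [← Matrix.mul_assoc Oᵀ, h, Matrix.mul_assoc]
  exact ⟨by rw [frobSq_eq_trace, this, frobSq_eq_trace], by rw [gramDet, this, gramDet]⟩

lemma continuous_frobSq {m n : ℕ} : Continuous (frobSq : Matrix (Fin m) (Fin n) ℝ → ℝ) := by
  unfold frobSq
  fun_prop

lemma isClosed_nearIsometry {m : ℕ} (Q : Matrix (Fin d) (Fin k) ℝ) (x : Fin d → ℝ) (ε : ℝ) :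
    IsClosed {W : Matrix (Fin m) (Fin d) ℝ | NearIsometry W Q x ε} := by
  have hWQ : Continuous fun W : Matrix (Fin m) (Fin d) ℝ => W * Q :=
    continuous_id.matrix_mul continuous_const
  have hf := continuous_frobSq.comp hWQ
  have hg : Continuous fun W : Matrix (Fin m) (Fin d) ℝ => gramDet (W * Q) :=
    (hWQ.matrix_transpose.matrix_mul hWQ).matrix_det
  have hx : Continuous fun W : Matrix (Fin m) (Fin d) ℝ => W *ᵥ x :=
    Continuous.matrix_mulVec continuous_id continuous_const
  refine IsClosed.inter (isClosed_le (continuous_frobSq.sub hf) continuous_const)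
    (IsClosed.inter (isClosed_le (f := fun W : Matrix (Fin m) (Fin d) ℝ =>
      Real.exp (frobSq (W * Q) - k - ε)) ?_ hg) (isClosed_le (f := fun W : Matrix (Fin m) (Fin d) ℝ =>
      ∑ i, min ((W *ᵥ x) i) 0 ^ 2) ?_ continuous_const))
  · exact Real.continuous_exp.comp ((hf.sub continuous_const).sub continuous_const)
  · exact continuous_finsetSum _ fun i _ =>
      (((continuous_apply i).comp hx).min continuous_const).pow 2

lemma eq_zero_of_frobSq_le_zero {m n : ℕ} {A : Matrix (Fin m) (Fin n) ℝ} (h : frobSq A ≤ 0) :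
    A = 0 := by
  ext i j
  have h1 : A i j ^ 2 ≤ frobSq A :=
    (Finset.single_le_sum (f := fun j => A i j ^ 2) (fun _ _ => sq_nonneg _) (Finset.mem_univ j)).trans
      (Finset.single_le_sum (f := fun i => ∑ j, A i j ^ 2)
        (fun _ _ => Finset.sum_nonneg fun _ _ => sq_nonneg _) (Finset.mem_univ i))
  have : A i j ^ 2 = 0 := le_antisymm (h1.trans h) (sq_nonneg _)
  simpa using this

/-- At zero error the determinant inequality is an equality, so `O Q` has orthonormal columns, and
`O` has no part off the range of `Q`. -/
lemma isometry_of_nearIsometry {m : ℕ} {O : Matrix (Fin m) (Fin d) ℝ}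
    {Q : Matrix (Fin d) (Fin k) ℝ} {x : Fin d → ℝ} (hQ : Qᵀ * Q = 1)
    (h : ∀ ε > 0, NearIsometry O Q x ε) : Oᵀ * O = Q * Qᵀ ∧ ∀ j, 0 ≤ (O *ᵥ x) j := by
  have h1 : frobSq O - frobSq (O * Q) ≤ 0 :=
    le_of_forall_pos_le_add fun ε hε => by simpa using (h ε hε).1
  have h3 : ∑ i, min ((O *ᵥ x) i) 0 ^ 2 ≤ 0 :=
    le_of_forall_pos_le_add fun ε hε => by simpa using (h ε hε).2.2
  have hpos : 0 < gramDet (O * Q) := (Real.exp_pos _).trans_le (h 1 one_pos).2.1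
  have h2 : frobSq (O * Q) - k ≤ Real.log (gramDet (O * Q)) :=
    le_of_forall_pos_le_add fun ε hε => by
      have := (Real.le_log_iff_exp_le hpos).mpr (h ε hε).2.1
      linarith
  have hiso : (O * Q)ᵀ * (O * Q) = 1 := by
    refine eq_one_of_exp_trace_le_det (posSemidef_transpose_mul_self _) ?_
    rw [← frobSq_eq_trace, Fintype.card_fin]
    exact (Real.le_log_iff_exp_le hpos).mp h2
  have hO : O = O * Q * Qᵀ := by
    rw [← sub_eq_zero]
    apply eq_zero_of_frobSq_le_zero
    linarith [frobSq_eq_add_of_orthonormal O hQ]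
  refine ⟨?_, fun j => ?_⟩
  · conv_lhs => rw [hO]
    rw [transpose_mul, transpose_transpose, Matrix.mul_assoc, ← Matrix.mul_assoc (O * Q)ᵀ, hiso,
      Matrix.one_mul]
  · have h4 : min ((O *ᵥ x) j) 0 ^ 2 ≤ 0 :=
      (Finset.single_le_sum (f := fun j => min ((O *ᵥ x) j) 0 ^ 2) (fun _ _ => sq_nonneg _)
        (Finset.mem_univ j)).trans h3
    have h5 : min ((O *ᵥ x) j) 0 = 0 := by
      have := le_antisymm h4 (sq_nonneg _)
      simpa only [ne_eq, OfNat.ofNat_ne_zero, not_false_eq_true, pow_eq_zero_iff] using this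
    exact min_eq_right_iff.mp h5

/-- Near isometries for arbitrarily small errors yield an isometry. -/
lemma exists_isometry_of_nearIsometry {ι : Type*} [Nonempty ι]
    (Q : ι → Matrix (Fin d) (Fin k) ℝ) (x : ι → Fin d → ℝ) (hQ : ∀ i, (Q i)ᵀ * Q i = 1)
    (H : ∀ ε > 0, ∃ (n : ℕ) (W : Matrix (Fin n) (Fin d) ℝ), ∀ i, NearIsometry W (Q i) (x i) ε) :
    ∃ (m : ℕ) (O : Matrix (Fin m) (Fin d) ℝ), ∀ i, Oᵀ * O = Q i * (Q i)ᵀ ∧ ∀ j, 0 ≤ (O *ᵥ x i) j := by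
  classical
  -- For errors at most `1`, `‖O Q‖² ≤ 2 (k + 1)` and the part off the range adds at most `1`.
  set R : ℝ := 2 * k + 3
  let K : Set (Matrix (Fin (d * d + 2)) (Fin d) ℝ) :=
    Set.pi Set.univ fun _ => Set.pi Set.univ fun _ => Set.Icc (-R) R
  have hK : IsCompact K := isCompact_univ_pi fun _ => isCompact_univ_pi fun _ => isCompact_Icc
  let C : Set.Ioi (0 : ℝ) × ι → Set (Matrix (Fin (d * d + 2)) (Fin d) ℝ) := fun j =>
    {O | NearIsometry O (Q j.2) (x j.2) j.1}
  obtain ⟨O, -, hO⟩ : (K ∩ ⋂ j, C j).Nonempty := by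
    refine hK.inter_iInter_nonempty C (fun j => isClosed_nearIsometry _ _ _) fun u => ?_
    obtain ⟨δ, -, hδ⟩ := (insert ⟨1, Set.mem_Ioi.mpr one_pos⟩ (u.image Prod.fst)).exists_min_image id
      (Finset.insert_nonempty _ _)
    have hδ1 : (δ : ℝ) ≤ 1 := hδ _ (Finset.mem_insert_self _ _)
    have hδu : ∀ j ∈ u, (δ : ℝ) ≤ j.1 := fun j hj =>
      hδ _ (Finset.mem_insert_of_mem (Finset.mem_image_of_mem _ hj))
    have hδ0 : (0 : ℝ) < δ := δ.2
    have hc : (0 : ℝ) < u.card + 1 := by positivity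
    -- The row reduction preserves a single extra quantity, here the sum of the negative parts over
    -- the finitely many constraints in `u`; dividing by `u.card + 1` keeps that sum below `δ`.
    obtain ⟨n, W, hW⟩ := H (δ / (u.card + 1)) (by positivity)
    have hle : (δ : ℝ) / (u.card + 1) ≤ δ := div_le_self hδ0.le (by linarith)
    obtain ⟨O, hOW, hOψ⟩ := exists_few_rows W (fun v => ∑ j ∈ u, min (v ⬝ᵥ x j.2) 0 ^ 2) (by
      intro c v hc
      rw [Finset.mul_sum]
      refine Finset.sum_congr rfl fun j _ => ?_
      rw [smul_dotProduct, smul_eq_mul, ← mul_pow, mul_min_of_nonneg _ _ hc, mul_zero])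
    have hfr : frobSq O = frobSq W := by rw [frobSq_eq_trace, hOW, frobSq_eq_trace]
    refine ⟨O, ?_, ?_⟩
    · obtain ⟨i⟩ := ‹Nonempty ι›
      have h1 := (hW i).mono hle
      have h2 := frobSq_le_of_exp_le_gramDet h1.2.1
      have h3 : frobSq O ≤ R := by rw [hfr]; linarith [h1.1]
      have hR : 1 ≤ R := by simp only [R]; linarith [Nat.cast_nonneg (α := ℝ) k]
      intro i _ j _
      have h4 : O i j ^ 2 ≤ frobSq O :=
        (Finset.single_le_sum (f := fun j => O i j ^ 2) (fun _ _ => sq_nonneg _)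
          (Finset.mem_univ j)).trans (Finset.single_le_sum (f := fun i => ∑ j, O i j ^ 2)
          (fun _ _ => Finset.sum_nonneg fun _ _ => sq_nonneg _) (Finset.mem_univ i))
      exact abs_le_of_sq_le_sq' (by nlinarith) (by linarith)
    · refine Set.mem_iInter₂.mpr fun j hj => ?_
      have h1 := (hW j.2).mono (hle.trans (hδu j hj))
      have h2 := frobSq_mul_of_gram_eq hOW (Q j.2)
      refine ⟨by rw [hfr, h2.1]; exact h1.1, by rw [h2.1, h2.2]; exact h1.2.1, ?_⟩
      calc ∑ i, min ((O *ᵥ x j.2) i) 0 ^ 2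
          ≤ ∑ i, ∑ j ∈ u, min (O i ⬝ᵥ x j.2) 0 ^ 2 := Finset.sum_le_sum fun i _ =>
            Finset.single_le_sum (f := fun j : Set.Ioi (0 : ℝ) × ι => min (O i ⬝ᵥ x j.2) 0 ^ 2)
              (fun _ _ => sq_nonneg _) hj
        _ = ∑ i, ∑ j ∈ u, min (W i ⬝ᵥ x j.2) 0 ^ 2 := hOψ
        _ = ∑ j ∈ u, ∑ i, min (W i ⬝ᵥ x j.2) 0 ^ 2 := Finset.sum_comm
        _ ≤ ∑ j ∈ u, (δ : ℝ) / (u.card + 1) := Finset.sum_le_sum fun j _ => (hW j.2).2.2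
        _ = u.card * ((δ : ℝ) / (u.card + 1)) := by simp
        _ ≤ δ := by rw [mul_div_assoc', div_le_iff₀ hc]; nlinarith
        _ ≤ j.1 := hδu j hj
  refine ⟨_, O, fun i => isometry_of_nearIsometry (hQ i) fun ε hε => ?_⟩
  exact Set.mem_iInter.mp hO (⟨ε, hε⟩, i)

end

/-! ### The lower bound and the necessity of planarity and complete positivity. -/

section

variable {a : ℝ} {d k : ℕ}

/-- An orthonormal frame of a subspace, as a matrix. -/
lemma exists_frame {T : Submodule ℝ (EuclideanSpace ℝ (Fin d))} (hT : Module.finrank ℝ T = k) :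
    ∃ Q : Matrix (Fin d) (Fin k) ℝ, Qᵀ * Q = 1 ∧ (∀ z, WithLp.toLp 2 (Q *ᵥ z) ∈ T) ∧
      ∀ v ∈ T, Q *ᵥ (Qᵀ *ᵥ v.ofLp) = v.ofLp := by
  let b : OrthonormalBasis (Fin k) ℝ T := (stdOrthonormalBasis ℝ T).reindex (finCongr hT)
  let Q : Matrix (Fin d) (Fin k) ℝ := fun i j => (b j : EuclideanSpace ℝ (Fin d)) i
  have hQz : ∀ z : Fin k → ℝ, WithLp.toLp 2 (Q *ᵥ z) =
      ∑ j, z j • (b j : EuclideanSpace ℝ (Fin d)) := by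
    intro z
    ext i
    simp [Q, mulVec, dotProduct, mul_comm]
  refine ⟨Q, ?_, fun z => ?_, fun v hv => ?_⟩
  · ext i j
    have h := b.inner_eq_ite j i
    rw [Submodule.coe_inner, PiLp.inner_apply] at h
    simp only [RCLike.inner_apply, conj_trivial] at h
    have h' : (Qᵀ * Q) i j = ∑ x, Q x i * Q x j := by simp only [mul_apply, transpose_apply]
    rw [h', one_apply]
    exact h.trans (by simp only [eq_comm])
  · rw [hQz]
    exact Submodule.sum_mem _ fun j _ => T.smul_mem _ (b j).2
  · have h1 := congrArg (Subtype.val) (b.sum_repr ⟨v, hv⟩)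
    have h2 : WithLp.toLp 2 (Q *ᵥ (Qᵀ *ᵥ v.ofLp)) = v := by
      refine (hQz _).trans (Eq.trans ?_ h1)
      rw [AddSubmonoidClass.coe_finsetSum]
      refine Finset.sum_congr rfl fun j _ => ?_
      rw [Submodule.coe_smul, b.repr_apply_apply, Submodule.coe_inner, PiLp.inner_apply]
      congr 1
      simp only [mulVec, dotProduct, RCLike.inner_apply, conj_trivial]
      exact Finset.sum_congr rfl fun x _ => mul_comm _ _
    exact congrArg WithLp.ofLp h2

/-- The network computes the identity on `Ω`. -/
def Net.IsIdOn (a : ℝ) {L : ℕ} (N : Net d L d) (Ω : Set (EuclideanSpace ℝ (Fin d))) : Prop :=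
  ∀ x ∈ Ω, ∀ i, N.eval a x.ofLp i = x i

lemma Net.IsIdOn.exists_jac_mul_eq {L : ℕ} {N : Net d L d} {Ω : Set (EuclideanSpace ℝ (Fin d))}
    (hN : N.IsIdOn a Ω) {x : EuclideanSpace ℝ (Fin d)} (hx : x ∈ Ω)
    {T : Submodule ℝ (EuclideanSpace ℝ (Fin d))} (hT : HasTangentSpace Ω x T)
    {Q : Matrix (Fin d) (Fin k) ℝ} (hQT : ∀ z, WithLp.toLp 2 (Q *ᵥ z) ∈ T) :
    ∃ p, N.Valid a p x.ofLp ∧ N.jac a p * Q = Q := by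
  obtain ⟨p, hp, h⟩ := N.exists_valid_jac_eq hN hx hT
  refine ⟨p, hp, Matrix.mulVec_injective (funext fun z => ?_)⟩
  rw [← mulVec_mulVec]
  exact h _ (hQT z)

lemma Net.excess_of_jac_mul_eq {L : ℕ} {N : Net d L d} {p : N.Pattern}
    {Q : Matrix (Fin d) (Fin k) ℝ} (hQ : Qᵀ * Q = 1) (h : N.jac a p * Q = Q) :
    gramDet (N.jac a p * Q) ≠ 0 ∧ N.excess a p Q = N.normSq - L * k := by
  unfold Net.excess
  rw [h, gramDet_of_orthonormal hQ]
  simp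

lemma Net.IsIdOn.le_normSq (ha : -1 < a ∧ a < 1) {L : ℕ} {N : Net d L d}
    {Ω : Set (EuclideanSpace ℝ (Fin d))} (hN : N.IsIdOn a Ω) {x : EuclideanSpace ℝ (Fin d)}
    (hx : x ∈ Ω) {T : Submodule ℝ (EuclideanSpace ℝ (Fin d))} (hT : HasTangentSpace Ω x T)
    (hk : Module.finrank ℝ T = k) : (L * k : ℝ) ≤ N.normSq := by
  obtain ⟨Q, hQ, hQT, -⟩ := exists_frame hk
  obtain ⟨p, -, hp⟩ := hN.exists_jac_mul_eq hx hT hQT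
  obtain ⟨h0, h1⟩ := Net.excess_of_jac_mul_eq hQ hp
  have := N.excess_nonneg ha p hQ h0
  linarith

lemma le_repCost_id (ha : -1 < a ∧ a < 1) {Ω : Set (EuclideanSpace ℝ (Fin d))}
    {x : EuclideanSpace ℝ (Fin d)} (hx : x ∈ Ω) {T : Submodule ℝ (EuclideanSpace ℝ (Fin d))}
    (hT : HasTangentSpace Ω x T) (hk : Module.finrank ℝ T = k) (L : ℕ) :
    ENNReal.ofReal (L * k) ≤ repCost a (id : EuclideanSpace ℝ (Fin d) → _) Ω L :=
  le_iInf₂ fun _ hN => ENNReal.ofReal_le_ofReal (Net.IsIdOn.le_normSq ha hN hx hT hk)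

/-- If the identity has networks of cost arbitrarily close to `k L`, then `Ω` passes through its
tangent spaces. -/
lemma mem_tangentSpace_of_small_cost (ha : -1 < a ∧ a < 1) {Ω : Set (EuclideanSpace ℝ (Fin d))}
    (H : ∀ ε > 0, ∃ (L : ℕ) (N : Net d L d), 2 ≤ L ∧ N.IsIdOn a Ω ∧ N.normSq ≤ L * k + ε)
    {x : EuclideanSpace ℝ (Fin d)} (hx : x ∈ Ω) {T : Submodule ℝ (EuclideanSpace ℝ (Fin d))}
    (hT : HasTangentSpace Ω x T) (hk : Module.finrank ℝ T = k) : x ∈ T := by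
  obtain ⟨Q, hQ, hQT, -⟩ := exists_frame hk
  have hcl : IsClosed (T : Set (EuclideanSpace ℝ (Fin d))) := T.closed_of_finiteDimensional
  rw [← SetLike.mem_coe, ← hcl.closure_eq, Metric.mem_closure_iff]
  intro δ hδ
  set η : ℝ := min (1 / 2) (δ / (2 * (‖x‖ + 2))) with hη
  have hx2 : 0 < ‖x‖ + 2 := by positivity
  have hη0 : 0 < η := lt_min (by norm_num) (by positivity)
  obtain ⟨L, N, -, hN, hcost⟩ := H (η ^ 2) (by positivity)
  obtain ⟨p, hpx, hp⟩ := hN.exists_jac_mul_eq hx hT hQT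
  obtain ⟨h0, h1⟩ := Net.excess_of_jac_mul_eq hQ hp
  obtain ⟨z, hz⟩ := N.exists_eval_near_range ha p hQ h0 hpx hη0.le (min_le_left _ _)
    (by linarith)
  have hev : N.eval a x.ofLp = x.ofLp := funext (hN x hx)
  rw [hp, hev, WithLp.toLp_sub] at hz
  refine ⟨_, hQT z, ?_⟩
  rw [dist_eq_norm]
  refine lt_of_le_of_lt hz ?_
  change η * (‖x‖ + 2) < δ
  calc η * (‖x‖ + 2) ≤ δ / (2 * (‖x‖ + 2)) * (‖x‖ + 2) := by
        gcongr; exact min_le_right _ _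
    _ = δ / 2 := by field_simp
    _ < δ := by linarith

lemma le_span_of_hasTangentSpace {Ω : Set (EuclideanSpace ℝ (Fin d))}
    {x : EuclideanSpace ℝ (Fin d)} (hx : x ∈ Ω) {T : Submodule ℝ (EuclideanSpace ℝ (Fin d))}
    (hT : HasTangentSpace Ω x T) : T ≤ Submodule.span ℝ Ω := by
  intro v hv
  have hv' : v ∈ tangentConeAt ℝ Ω x := by rw [hT]; exact hv
  obtain ⟨α, l, hl, c, u, -, huΩ, hcu⟩ := exists_fun_of_mem_tangentConeAt hv'
  refine (Submodule.span ℝ Ω).closed_of_finiteDimensional.mem_of_tendsto hcu ?_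
  filter_upwards [huΩ] with n hn
  have h1 := Submodule.sub_mem _ (Submodule.subset_span hn : _ ∈ Submodule.span ℝ Ω)
    (Submodule.subset_span hx)
  rw [add_sub_cancel_left] at h1
  exact Submodule.smul_mem _ _ h1

/-- If the identity has networks of cost arbitrarily close to `k L`, then `Ω` is `k`-planar and
completely positive. -/
lemma planar_and_completelyPositive_of_small_cost (ha : -1 < a ∧ a < 1)
    {Ω : Set (EuclideanSpace ℝ (Fin d))} (hbdd : Bornology.IsBounded Ω) (hne : Ω.Nonempty)
    (hdense : Ω ⊆ closure {x : EuclideanSpace ℝ (Fin d) | x ∈ Ω ∧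
      ∃ T : Submodule ℝ (EuclideanSpace ℝ (Fin d)),
        HasTangentSpace Ω x T ∧ Module.finrank ℝ T = k})
    (H : ∀ ε > 0, ∃ (L : ℕ) (N : Net d L d), 2 ≤ L ∧ N.IsIdOn a Ω ∧ N.normSq ≤ L * k + ε) :
    IsPlanar Ω k ∧ IsCompletelyPositive Ω := by
  set Ω' := {x : EuclideanSpace ℝ (Fin d) | x ∈ Ω ∧
      ∃ T : Submodule ℝ (EuclideanSpace ℝ (Fin d)),
        HasTangentSpace Ω x T ∧ Module.finrank ℝ T = k}
  have hΩ' : ∀ x : Ω', x.1 ∈ Ω := fun x => x.2.1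
  have hne' : Ω'.Nonempty := closure_nonempty_iff.mp (hne.mono hdense)
  have hnonempty : Nonempty Ω' := hne'.to_subtype
  obtain ⟨x₀⟩ := id hnonempty
  choose T hT hk using fun x : Ω' => x.2.2
  choose Q hQ hQT hQv using fun x : Ω' => exists_frame (hk x)
  have hxT : ∀ x : Ω', x.1 ∈ T x := fun x =>
    mem_tangentSpace_of_small_cost ha H (hΩ' x) (hT x) (hk x)
  -- The near-isometry error grows with `‖x‖²`; boundedness of `Ω` allows one network to serve all
  -- points at once.
  obtain ⟨K, hK⟩ := hbdd.exists_norm_le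
  have ha2 : 0 < 1 - a ^ 2 := by nlinarith [ha.1, ha.2]
  have hK2 : 0 < 1 + K ^ 2 / (1 - a ^ 2) := by positivity
  obtain ⟨m, O, hO⟩ := exists_isometry_of_nearIsometry Q (fun x : Ω' => x.1.ofLp) hQ (by
    intro ε hε
    obtain ⟨L, N, hL, hN, hcost⟩ := H (ε / (1 + K ^ 2 / (1 - a ^ 2))) (by positivity)
    obtain ⟨n, W, b, hW⟩ := N.exists_first_layer (k := k) ha hL
    refine ⟨n, W, fun x => ?_⟩
    obtain ⟨p, hpx, hp⟩ := hN.exists_jac_mul_eq (hΩ' x) (hT x) (hQT x)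
    obtain ⟨h0, h1⟩ := Net.excess_of_jac_mul_eq (hQ x) hp
    obtain ⟨s, hs, hs0, hse⟩ := hW p _ hpx (Q x) h0
    rw [← hQv x _ (hxT x)] at hs
    have h2 := nearIsometry_of_small_excess ha (hQ x) hs hs0
      (ε := ε / (1 + K ^ 2 / (1 - a ^ 2))) (by linarith)
    rw [hQv x _ (hxT x)] at h2
    refine h2.mono ?_
    have h3 : sqNorm ((Q x)ᵀ *ᵥ x.1.ofLp) ≤ K ^ 2 := by
      rw [← sqNorm_mulVec_of_orthonormal (hQ x), hQv x _ (hxT x), sqNorm_eq_norm_sq]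
      exact pow_le_pow_left₀ (norm_nonneg _) (hK _ (hΩ' x)) 2
    rw [div_mul_eq_mul_div, div_le_iff₀ hK2]
    gcongr)
  -- All tangent projections equal the same `Oᵀ O`, so the tangent spaces coincide.
  have hQQ : ∀ x : Ω', Q x * (Q x)ᵀ = Q x₀ * (Q x₀)ᵀ := fun x => by
    rw [← (hO x).1, ← (hO x₀).1]
  have hΩT : Ω ⊆ T x₀ := by
    refine hdense.trans (closure_minimal (fun x hx => ?_) (T x₀).closed_of_finiteDimensional)
    have h1 := hQv ⟨x, hx⟩ _ (hxT ⟨x, hx⟩)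
    rw [mulVec_mulVec, hQQ, ← mulVec_mulVec] at h1
    have h2 := hQT x₀ ((Q x₀)ᵀ *ᵥ x.ofLp)
    rw [h1] at h2
    exact h2
  have hspan : Submodule.span ℝ Ω = T x₀ :=
    le_antisymm (Submodule.span_le.mpr hΩT) (le_span_of_hasTangentSpace (hΩ' x₀) (hT x₀))
  refine ⟨by rw [IsPlanar, hspan, hk], m, ⟨toEuclideanLin O ∘ₗ (Submodule.span ℝ Ω).subtype, ?_⟩,
    fun x hx i => ?_⟩
  · intro v
    have hv : v.1 ∈ T x₀ := hspan ▸ v.2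
    refine (sq_eq_sq₀ (norm_nonneg _) (norm_nonneg _)).mp ?_
    have h1 : ‖v‖ ^ 2 = sqNorm v.1.ofLp := by rw [sqNorm_eq_norm_sq]; rfl
    have h2 : ‖(toEuclideanLin O ∘ₗ (Submodule.span ℝ Ω).subtype) v‖ ^ 2
        = sqNorm (O *ᵥ v.1.ofLp) := by rw [sqNorm_eq_norm_sq]; rfl
    rw [h1, h2, sqNorm_eq_dotProduct, sqNorm_eq_dotProduct, dotProduct_mulVec, vecMul_mulVec,
      ← dotProduct_mulVec, (hO x₀).1, ← mulVec_mulVec, hQv x₀ _ hv]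
  · change 0 ≤ (O *ᵥ x.ofLp) i
    have hcl : IsClosed {y : EuclideanSpace ℝ (Fin d) | 0 ≤ (O *ᵥ y.ofLp) i} := by
      have h : Continuous fun y : EuclideanSpace ℝ (Fin d) => O *ᵥ y.ofLp :=
        Continuous.matrix_mulVec continuous_const (PiLp.continuous_ofLp 2 _)
      exact isClosed_le continuous_const ((continuous_apply i).comp h)
    exact closure_minimal (fun y hy => (hO ⟨y, hy⟩).2 i) hcl (hdense hx)

end

/-! ### Optimal networks on planar completely positive sets. -/

section

variable {a : ℝ} {d k : ℕ}

lemma sigma_of_nonneg {t : ℝ} (ht : 0 ≤ t) : sigma a t = t := if_pos ht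

lemma frobSq_mul_transpose_of_orthonormal {m n : ℕ} {C : Matrix (Fin m) (Fin k) ℝ}
    {Q : Matrix (Fin n) (Fin k) ℝ} (hC : Cᵀ * C = 1) (hQ : Qᵀ * Q = 1) :
    frobSq (C * Qᵀ) = k := by
  rw [frobSq_eq_trace, transpose_mul, transpose_transpose, Matrix.mul_assoc, ← Matrix.mul_assoc Cᵀ,
    hC, Matrix.one_mul, trace_mul_comm, hQ]
  simp

/-- A network whose first layer is `W` and whose other layers are the linear map `P`. -/
def linearNet {m : ℕ} (W : Matrix (Fin m) (Fin d) ℝ) (P : Matrix (Fin m) (Fin m) ℝ) :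
    (l : ℕ) → Net d (l + 1) m
  | 0 => .first W 0
  | l + 1 => .layer (linearNet W P l) P 0

lemma linearNet_normSq {m : ℕ} (W : Matrix (Fin m) (Fin d) ℝ) (P : Matrix (Fin m) (Fin m) ℝ)
    (l : ℕ) : (linearNet W P l).normSq = frobSq W + l * frobSq P := by
  induction l with
  | zero => simp [linearNet, Net.normSq, frobSq]
  | succ l ih => simp [linearNet, Net.normSq, ih, frobSq]; ring

lemma linearNet_eval {m : ℕ} {W : Matrix (Fin m) (Fin d) ℝ} {P : Matrix (Fin m) (Fin m) ℝ}
    {x : Fin d → ℝ} (hx : ∀ i, 0 ≤ (W *ᵥ x) i) (hP : P *ᵥ (W *ᵥ x) = W *ᵥ x) (l : ℕ) :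
    (linearNet W P l).eval a x = W *ᵥ x := by
  induction l with
  | zero => simp [linearNet, Net.eval]
  | succ l ih =>
    simp only [linearNet, Net.eval, ih, add_zero]
    conv_rhs => rw [← hP]
    congr 1
    exact funext fun i => sigma_of_nonneg (hx i)

/-- On a completely positive `k`-planar set, the identity has networks of depth `L` and cost
`k L`. -/
lemma exists_net_of_planar_of_completelyPositive {Ω : Set (EuclideanSpace ℝ (Fin d))}
    (hpl : IsPlanar Ω k) (hcp : IsCompletelyPositive Ω) (l : ℕ) :
    ∃ N : Net d (l + 2) d, N.IsIdOn a Ω ∧ N.normSq = ((l + 2 : ℕ) : ℝ) * k := by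
  obtain ⟨Q, hQ, hQT, hQv⟩ := exists_frame hpl
  obtain ⟨m, O, hO⟩ := hcp
  let φ : (Fin k → ℝ) →ₗ[ℝ] Submodule.span ℝ Ω := LinearMap.codRestrict _
    ((WithLp.linearEquiv 2 ℝ (Fin d → ℝ)).symm.toLinearMap ∘ₗ Q.mulVecLin) hQT
  obtain ⟨C, hCz⟩ : ∃ C : Matrix (Fin m) (Fin k) ℝ,
      ∀ z, WithLp.toLp 2 (C *ᵥ z) = O ⟨WithLp.toLp 2 (Q *ᵥ z), hQT z⟩ := by
    refine ⟨LinearMap.toMatrix' ((WithLp.linearEquiv 2 ℝ (Fin m → ℝ)).toLinearMap ∘ₗ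
      O.toLinearMap ∘ₗ φ), fun z => ?_⟩
    rw [LinearMap.toMatrix'_mulVec]
    rfl
  have hC : Cᵀ * C = 1 := by
    ext i j
    have h1 : (Cᵀ * C) i j
        = inner ℝ (WithLp.toLp 2 (C *ᵥ Pi.single j 1)) (WithLp.toLp 2 (C *ᵥ Pi.single i 1)) := by
      simp [mul_apply, PiLp.inner_apply]
    have h2 : (Qᵀ * Q) i j
        = inner ℝ (WithLp.toLp 2 (Q *ᵥ Pi.single j 1)) (WithLp.toLp 2 (Q *ᵥ Pi.single i 1)) := by
      simp [mul_apply, PiLp.inner_apply]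
    rw [h1, hCz, hCz, O.inner_map_map, Submodule.coe_inner, ← h2, hQ]
  have hx : ∀ x ∈ Ω, Q *ᵥ (Qᵀ *ᵥ x.ofLp) = x.ofLp := fun x hx => hQv x (Submodule.subset_span hx)
  have hCx : ∀ x ∈ Ω, ∀ i, 0 ≤ ((C * Qᵀ) *ᵥ x.ofLp) i := by
    intro x hxΩ i
    have h1 := hO x hxΩ i
    have h2 := hCz (Qᵀ *ᵥ x.ofLp)
    have h3 : (⟨WithLp.toLp 2 (Q *ᵥ (Qᵀ *ᵥ x.ofLp)), hQT _⟩ : Submodule.span ℝ Ω)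
        = ⟨x, Submodule.subset_span hxΩ⟩ := Subtype.ext (congrArg (WithLp.toLp 2) (hx x hxΩ))
    rw [h3] at h2
    rw [← h2] at h1
    rwa [← mulVec_mulVec]
  have hev : ∀ x ∈ Ω, (linearNet (C * Qᵀ) (C * Cᵀ) l).eval a x.ofLp = (C * Qᵀ) *ᵥ x.ofLp := by
    intro x hxΩ
    refine linearNet_eval (hCx x hxΩ) ?_ l
    rw [mulVec_mulVec, Matrix.mul_assoc, ← Matrix.mul_assoc Cᵀ, hC, Matrix.one_mul]
  -- The hidden state stays at `C Qᵀ x`, which is nonnegative and fixed by `C Cᵀ`, so no activation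
  -- changes it and `Q Cᵀ` recovers `x`.
  refine ⟨.layer (linearNet (C * Qᵀ) (C * Cᵀ) l) (Q * Cᵀ) 0, fun x hxΩ i => ?_, ?_⟩
  · simp only [Net.eval, hev x hxΩ, add_zero]
    have h1 : (fun i => sigma a (((C * Qᵀ) *ᵥ x.ofLp) i)) = (C * Qᵀ) *ᵥ x.ofLp :=
      funext fun i => sigma_of_nonneg (hCx x hxΩ i)
    rw [h1, mulVec_mulVec, Matrix.mul_assoc, ← Matrix.mul_assoc Cᵀ, hC, Matrix.one_mul,
      ← mulVec_mulVec, hx x hxΩ]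
  · change (linearNet (C * Qᵀ) (C * Cᵀ) l).normSq + (frobSq (Q * Cᵀ) + sqNorm 0) = _
    rw [linearNet_normSq, frobSq_mul_transpose_of_orthonormal hC hQ,
      frobSq_mul_transpose_of_orthonormal hC hC, frobSq_mul_transpose_of_orthonormal hQ hC]
    simp [sqNorm]
    ring

end

/-! ### Finite piecewise linear functions are network functions. -/

section

/-- A continuous function on `[0, 1]` made of finitely many affine pieces has a piece which is
below it at `0` and above it at `1`. -/
lemma exists_piece_le_and_ge {ι : Type*} [Finite ι] {g : ℝ → ℝ} (hg : Continuous g) (p q : ι → ℝ)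
    (h : ∀ t, ∃ i, g t = p i + q i * t) : ∃ i, p i ≤ g 0 ∧ g 1 ≤ p i + q i := by
  by_contra! hcon
  set c := g 1 - g 0 with hc
  set f : ℝ → ℝ := fun t => g t - g 0 - c * t with hf
  have hfc : Continuous f := by fun_prop
  -- `f` measures `g` against its chord. A piece meeting the chord with slope at least `c` would lie
  -- below it at `0` and above it at `1`, contrary to `hcon`. Hence `f` cannot cross zero upwards
  -- and stays nonpositive.
  have hslope : ∀ i t, 0 ≤ t → t ≤ 1 → g t = p i + q i * t → f t = 0 → q i < c := by
    intro i t ht0 ht1 hgt hft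
    have h1 : p i - g 0 + (q i - c) * t = 0 := by simp only [hf] at hft; linarith
    by_contra! hqc
    by_cases hp : p i ≤ g 0
    · have h2 := hcon i hp
      nlinarith
    · nlinarith [mul_nonneg (sub_nonneg.mpr hqc) ht0]
  have hactive : ∀ (t : ℝ) (l : Filter ℝ) [l.NeBot], l ≤ 𝓝 t →
      ∃ i, (∃ᶠ z in l, g z = p i + q i * z) ∧ g t = p i + q i * t := by
    intro t l _ hl
    have h1 : ∃ i, ∃ᶠ z in l, g z = p i + q i * z := by
      by_contra! hno
      obtain ⟨z, hz⟩ := (eventually_all.mpr hno).exists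
      obtain ⟨i, hi⟩ := h z
      exact hz i hi
    obtain ⟨i, hi⟩ := h1
    refine ⟨i, hi, ?_⟩
    have hcl : IsClosed {z | g z = p i + q i * z} := isClosed_eq hg (by fun_prop)
    exact hcl.mem_of_frequently_of_tendsto hi hl
  choose j hjf hjt using fun t : ℝ => hactive t (𝓝[>] t) nhdsWithin_le_nhds
  have hle : ∀ ⦃x⦄, x ∈ Set.Icc (0 : ℝ) 1 → f x ≤ 0 := by
    refine image_le_of_liminf_slope_right_lt_deriv_boundary' (f' := fun t => q (j t) - c)
      (B := fun _ => 0) (B' := fun _ => 0) hfc.continuousOn ?_ (by simp [hf]) continuousOn_const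
      (fun x _ => hasDerivWithinAt_const _ _ _) ?_
    · intro x _ r hr
      refine ((hjf x).and_eventually self_mem_nhdsWithin).mono fun z hz => ?_
      have hxz : z - x ≠ 0 := sub_ne_zero.mpr (ne_of_gt hz.2)
      have : _root_.slope f x z = q (j x) - c := by
        rw [slope_def_field, div_eq_iff hxz]
        simp only [hf]
        linear_combination hz.1 - hjt x
      rwa [this]
    · intro x hx hfx
      exact sub_neg.mpr (hslope _ x hx.1 hx.2.le (hjt x) hfx)
  have hf1 : f 1 = 0 := by simp [hf, hc]
  -- A piece active just left of `1` passes through the chord's endpoint with slope below `c`,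
  -- making `f` positive there: a contradiction.
  obtain ⟨i, hi, hi1⟩ := hactive 1 (𝓝[<] 1) nhdsWithin_le_nhds
  have hq := hslope i 1 zero_le_one le_rfl hi1 hf1
  have hev : ∀ᶠ z : ℝ in 𝓝[<] 1, 0 ≤ z ∧ z < 1 := by
    filter_upwards [self_mem_nhdsWithin, nhdsWithin_le_nhds (lt_mem_nhds zero_lt_one)] with z h1 h2
    exact ⟨h2.le, h1⟩
  obtain ⟨z, hz, hz0, hz1⟩ := (hi.and_eventually hev).exists
  have h1 := hle ⟨hz0, hz1.le⟩
  simp only [hf] at h1 hf1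
  nlinarith [mul_pos (sub_pos.mpr hq) (sub_pos.mpr hz1)]

variable {a : ℝ} {n : ℕ}

/-- The scalar functions computed by networks with `L` hidden layers. -/
def netFun (a : ℝ) (n : ℕ) : ℕ → Submodule ℝ ((Fin n → ℝ) → ℝ)
  | 0 => Submodule.span ℝ (insert 1 (Set.range fun (j : Fin n) (x : Fin n → ℝ) => x j))
  | L + 1 => Submodule.span ℝ (insert 1 ((fun (h : (Fin n → ℝ) → ℝ) (x : Fin n → ℝ) =>
      sigma a (h x)) '' (netFun a n L : Set ((Fin n → ℝ) → ℝ))))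

lemma one_mem_netFun (L : ℕ) : (1 : (Fin n → ℝ) → ℝ) ∈ netFun a n L := by
  cases L <;> exact Submodule.subset_span (Set.mem_insert _ _)

lemma sigma_mem_netFun {L : ℕ} {f : (Fin n → ℝ) → ℝ} (hf : f ∈ netFun a n L) :
    (fun x => sigma a (f x)) ∈ netFun a n (L + 1) :=
  Submodule.subset_span (Set.mem_insert_of_mem _ ⟨f, hf, rfl⟩)

lemma sigma_sub_sigma_neg (t : ℝ) : sigma a t - sigma a (-t) = (1 + a) * t := by
  unfold sigma
  split_ifs with h1 h2 h2
  · have : t = 0 := by linarith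
    simp [this]
  · ring
  · ring
  · linarith

lemma sigma_add_sigma_neg (t : ℝ) : sigma a t + sigma a (-t) = (1 - a) * |t| := by
  unfold sigma
  split_ifs with h1 h2 h2
  · have : t = 0 := by linarith
    simp [this]
  · rw [abs_of_nonneg h1]; ring
  · rw [abs_of_neg (not_le.mp h1)]; ring
  · linarith

/-- Since `a ≠ -1`, the odd part of the activation recovers `f`, so any function survives an extra
layer. The even part likewise gives `|f|` because `a ≠ 1`. -/
lemma netFun_le_succ (ha : -1 < a ∧ a < 1) (L : ℕ) : netFun a n L ≤ netFun a n (L + 1) := by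
  intro f hf
  have h1 := Submodule.smul_mem _ (1 + a)⁻¹
    (Submodule.sub_mem _ (sigma_mem_netFun hf) (sigma_mem_netFun (Submodule.neg_mem _ hf)))
  convert h1 using 1
  ext x
  have : 1 + a ≠ 0 := by linarith [ha.1]
  simp only [Pi.smul_apply, Pi.sub_apply, Pi.neg_apply, sigma_sub_sigma_neg, smul_eq_mul]
  field_simp

lemma netFun_mono (ha : -1 < a ∧ a < 1) : Monotone (netFun a n) :=
  monotone_nat_of_le_succ (netFun_le_succ ha)

lemma abs_mem_netFun (ha : -1 < a ∧ a < 1) {L : ℕ} {f : (Fin n → ℝ) → ℝ}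
    (hf : f ∈ netFun a n L) : |f| ∈ netFun a n (L + 1) := by
  have h1 := Submodule.smul_mem _ (1 - a)⁻¹
    (Submodule.add_mem _ (sigma_mem_netFun hf) (sigma_mem_netFun (Submodule.neg_mem _ hf)))
  convert h1 using 1
  ext x
  have : 1 - a ≠ 0 := by linarith [ha.2]
  simp only [Pi.smul_apply, Pi.add_apply, Pi.neg_apply, sigma_add_sigma_neg, smul_eq_mul,
    Pi.abs_apply]
  field_simp

/-- The scalar functions computed by networks of some depth. -/
def netFunSet (a : ℝ) (n : ℕ) : Set ((Fin n → ℝ) → ℝ) := {f | ∃ L, f ∈ netFun a n L}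

lemma sup_mem_netFunSet (ha : -1 < a ∧ a < 1) {f g : (Fin n → ℝ) → ℝ} (hf : f ∈ netFunSet a n)
    (hg : g ∈ netFunSet a n) : f ⊔ g ∈ netFunSet a n := by
  obtain ⟨L, hL⟩ := hf
  obtain ⟨M, hM⟩ := hg
  have hf' := netFun_mono (n := n) ha (le_max_left L M) hL
  have hg' := netFun_mono (n := n) ha (le_max_right L M) hM
  refine ⟨max L M + 1, ?_⟩
  have := Submodule.smul_mem _ (1 / 2 : ℝ) (Submodule.add_mem _
    (netFun_le_succ ha _ (Submodule.add_mem _ hf' hg'))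
    (abs_mem_netFun ha (Submodule.sub_mem _ hf' hg')))
  convert this using 1
  ext x
  simp only [Pi.sup_apply, Pi.smul_apply, Pi.add_apply, Pi.abs_apply, Pi.sub_apply, smul_eq_mul]
  rcases le_total (f x) (g x) with h | h
  · rw [max_eq_right h, abs_of_nonpos (by linarith)]; ring
  · rw [max_eq_left h, abs_of_nonneg (by linarith)]; ring

lemma inf_mem_netFunSet (ha : -1 < a ∧ a < 1) {f g : (Fin n → ℝ) → ℝ} (hf : f ∈ netFunSet a n)
    (hg : g ∈ netFunSet a n) : f ⊓ g ∈ netFunSet a n := by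
  have hneg : ∀ {f : (Fin n → ℝ) → ℝ}, f ∈ netFunSet a n → -f ∈ netFunSet a n :=
    fun ⟨L, hL⟩ => ⟨L, Submodule.neg_mem _ hL⟩
  have := hneg (sup_mem_netFunSet ha (hneg hf) (hneg hg))
  rwa [neg_sup, neg_neg, neg_neg] at this

/-- A continuous function with finitely many affine pieces is a maximum of minima of its pieces,
hence computed by a network. -/
lemma mem_netFunSet_of_pieces (ha : -1 < a ∧ a < 1) {f : (Fin n → ℝ) → ℝ} (hf : Continuous f)
    (s : Finset ((Fin n → ℝ) → ℝ)) (hs : ∀ A ∈ s, ∃ (w : Fin n → ℝ) (b : ℝ), ∀ x, A x = w ⬝ᵥ x + b)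
    (hfs : ∀ x, ∃ A ∈ s, f x = A x) : f ∈ netFunSet a n := by
  classical
  have hs0 : ∀ A ∈ s, A ∈ netFunSet a n := by
    intro A hA
    obtain ⟨w, b, hwb⟩ := hs A hA
    refine ⟨0, ?_⟩
    have h1 : A = b • (1 : (Fin n → ℝ) → ℝ) + ∑ j, w j • fun x : Fin n → ℝ => x j := by
      ext x
      rw [hwb]
      simp [dotProduct, add_comm]
    rw [h1]
    refine Submodule.add_mem _ (Submodule.smul_mem _ _ (one_mem_netFun 0))
      (Submodule.sum_mem _ fun j _ => Submodule.smul_mem _ _ (Submodule.subset_span ?_))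
    exact Set.mem_insert_of_mem _ ⟨j, rfl⟩
  -- Restricting to the segment from `x` to `y` reduces this to one variable. It shows that each
  -- minimum over `S y` lies below `f` everywhere, while at `y` it is at least `f y`.
  have hpair : ∀ x y, ∃ A ∈ s, A x ≤ f x ∧ f y ≤ A y := by
    intro x y
    choose w b hwb using fun A : s => hs A A.2
    obtain ⟨A, h1, h2⟩ := exists_piece_le_and_ge (g := fun t => f (x + t • (y - x))) (by fun_prop)
      (fun A : s => w A ⬝ᵥ x + b A) (fun A => w A ⬝ᵥ (y - x)) (by
        intro t
        obtain ⟨A, hA, h⟩ := hfs (x + t • (y - x))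
        refine ⟨⟨A, hA⟩, ?_⟩
        have h' := hwb ⟨A, hA⟩ (x + t • (y - x))
        simp only [dotProduct_add, dotProduct_smul, smul_eq_mul] at h'
        rw [h, h']
        ring)
    refine ⟨A, A.2, ?_, ?_⟩
    · rw [hwb]; simpa using h1
    · have h3 : f y ≤ w A ⬝ᵥ x + b A + w A ⬝ᵥ (y - x) := by simpa using h2
      rw [hwb]
      rw [dotProduct_sub] at h3
      linarith
  let S : (Fin n → ℝ) → Finset ((Fin n → ℝ) → ℝ) := fun y => s.filter fun A => f y ≤ A y
  have hSne : ∀ y, (S y).Nonempty := fun y => by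
    obtain ⟨A, hA, h⟩ := hfs y
    exact ⟨A, Finset.mem_filter.mpr ⟨hA, h.le⟩⟩
  let G : Finset ((Fin n → ℝ) → ℝ) → ((Fin n → ℝ) → ℝ) := fun t =>
    if h : t.Nonempty then t.inf' h id else 0
  have hG : ∀ y, G (S y) = (S y).inf' (hSne y) id := fun y => dif_pos (hSne y)
  let P : Finset (Finset ((Fin n → ℝ) → ℝ)) := s.powerset.filter fun t => ∃ y, S y = t
  have hP : ∀ y, S y ∈ P := fun y =>
    Finset.mem_filter.mpr ⟨Finset.mem_powerset.mpr (Finset.filter_subset _ _), y, rfl⟩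
  have hPne : P.Nonempty := ⟨_, hP 0⟩
  have hfP : f = P.sup' hPne G := by
    ext x
    rw [Finset.sup'_apply]
    refine le_antisymm ?_ (Finset.sup'_le _ _ fun t ht => ?_)
    · refine le_trans ?_ (Finset.le_sup' (fun t => G t x) (hP x))
      rw [hG, Finset.inf'_apply]
      exact Finset.le_inf' _ _ fun A hA => (Finset.mem_filter.mp hA).2
    · obtain ⟨-, y, rfl⟩ := Finset.mem_filter.mp ht
      rw [hG, Finset.inf'_apply]
      obtain ⟨A, hA, h1, h2⟩ := hpair x y
      exact (Finset.inf'_le (fun A : (Fin n → ℝ) → ℝ => A x) (Finset.mem_filter.mpr ⟨hA, h2⟩)).trans h1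
  rw [hfP]
  refine Finset.sup'_mem (netFunSet a n) (fun _ h _ h' => sup_mem_netFunSet ha h h') P hPne G
    fun t ht => ?_
  obtain ⟨-, y, rfl⟩ := Finset.mem_filter.mp ht
  rw [hG]
  exact Finset.inf'_mem (netFunSet a n) (fun _ h _ h' => inf_mem_netFunSet ha h h') (S y) (hSne y) id
    fun A hA => hs0 A (Finset.mem_filter.mp hA).1

/-- Finitely many functions of `netFun a n L` are computed by a single network. -/
lemma exists_net_of_mem_netFun (L : ℕ) {m : ℕ} (f : Fin m → (Fin n → ℝ) → ℝ)
    (hf : ∀ i, f i ∈ netFun a n L) : ∃ N : Net n (L + 1) m, ∀ x i, N.eval a x i = f i x := by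
  induction L generalizing m with
  | zero =>
    have h : ∀ i, ∃ (b : ℝ) (w : Fin n → ℝ), ∀ x, f i x = w ⬝ᵥ x + b := by
      intro i
      obtain ⟨b, z, hz, hfi⟩ := Submodule.mem_span_insert.mp (hf i)
      obtain ⟨w, rfl⟩ := (Submodule.mem_span_range_iff_exists_fun ℝ).mp hz
      refine ⟨b, w, fun x => ?_⟩
      rw [hfi]
      simp [dotProduct, add_comm]
    choose b w hbw using h
    exact ⟨.first w b, fun x i => (hbw i x).symm⟩
  | succ L ih =>
    have h : ∀ i, ∃ (b : ℝ) (l : ℕ) (c : Fin l → ℝ) (g : Fin l → (Fin n → ℝ) → ℝ),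
        (∀ j, g j ∈ netFun a n L) ∧ ∀ x, f i x = ∑ j, c j * sigma a (g j x) + b := by
      intro i
      obtain ⟨b, z, hz, hfi⟩ := Submodule.mem_span_insert.mp (hf i)
      obtain ⟨l, c, g, rfl⟩ := Submodule.mem_span_set'.mp hz
      choose g' hg' hgg' using fun j => (g j).2
      refine ⟨b, l, c, g', hg', fun x => ?_⟩
      rw [hfi]
      simp [add_comm, ← hgg']
    choose b l c g hg hfg using h
    -- The hidden units of all outputs are stacked into one layer; each output reads only its own
    -- block.
    let e : (Σ i, Fin (l i)) ≃ Fin (Fintype.card (Σ i, Fin (l i))) := Fintype.equivFin _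
    obtain ⟨N, hN⟩ := ih (fun j => g (e.symm j).1 (e.symm j).2) (fun j => hg _ _)
    refine ⟨.layer N (fun i j => if (e.symm j).1 = i then c _ (e.symm j).2 else 0) b,
      fun x i => ?_⟩
    simp only [Net.eval, Pi.add_apply, hfg, mulVec, dotProduct, hN]
    congr 1
    rw [← e.sum_comp]
    simp only [Equiv.symm_apply_apply, Fintype.sum_sigma, ite_mul, zero_mul]
    rw [Finset.sum_eq_single i (fun j _ hj => by simp [hj]) (by simp)]
    refine Finset.sum_congr rfl fun j _ => ?_
    rw [if_pos rfl, e.symm_apply_apply]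

end

/-! ### The upper bound from the bottleneck rank. -/

section

variable {a : ℝ} {d k : ℕ}

/-- Composition of networks, with an activation in between. -/
def Net.comp {L n : ℕ} (N₁ : Net d L n) : {M m : ℕ} → Net n M m → Net d (L + M) m
  | _, _, .first W b => .layer N₁ W b
  | _, _, .layer N₂ W b => .layer (N₁.comp N₂) W b

lemma Net.comp_eval {L n M m : ℕ} (N₁ : Net d L n) (N₂ : Net n M m) (x : Fin d → ℝ) :
    (N₁.comp N₂).eval a x = N₂.eval a fun i => sigma a (N₁.eval a x i) := by
  induction N₂ with
  | first W b => rfl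
  | layer N₂ W b ih => simp only [Net.comp, Net.eval, ih]

lemma Net.comp_normSq {L n M m : ℕ} (N₁ : Net d L n) (N₂ : Net n M m) :
    (N₁.comp N₂).normSq = N₁.normSq + N₂.normSq := by
  induction N₂ with
  | first W b => rfl
  | layer N₂ W b ih => simp only [Net.comp, Net.normSq, ih, add_assoc]

/-- A network followed by `l` identity layers. -/
def Net.pad {L n : ℕ} (N : Net d L n) : (l : ℕ) → Net d (L + l) n
  | 0 => N
  | l + 1 => .layer (N.pad l) 1 0

lemma Net.pad_eval {L n : ℕ} (N : Net d L n) {x : Fin d → ℝ} (hx : ∀ i, 0 ≤ N.eval a x i) (l : ℕ) :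
    (N.pad l).eval a x = N.eval a x := by
  induction l with
  | zero => rfl
  | succ l ih =>
    simp only [Net.pad, Net.eval, ih, one_mulVec, add_zero]
    exact funext fun i => sigma_of_nonneg (hx i)

lemma Net.pad_normSq {L n : ℕ} (N : Net d L n) (l : ℕ) :
    (N.pad l).normSq = N.normSq + l * n := by
  induction l with
  | zero => simp [Net.pad]
  | succ l ih =>
    have h : frobSq (1 : Matrix (Fin n) (Fin n) ℝ) = n := by simp [frobSq_eq_trace]
    change (N.pad l).normSq + (frobSq (1 : Matrix (Fin n) (Fin n) ℝ) + sqNorm (0 : Fin n → ℝ)) = _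
    rw [ih, h]
    simp [sqNorm]
    ring

/-- Finite piecewise linear functions are computed by networks, also after translations. -/
lemma IsFPLF.exists_net (ha : -1 < a ∧ a < 1) {n m : ℕ}
    {f : EuclideanSpace ℝ (Fin n) → EuclideanSpace ℝ (Fin m)} (hf : IsFPLF f)
    (u : Fin n → ℝ) (v : Fin m → ℝ) :
    ∃ (L : ℕ) (N : Net n (L + 1) m), ∀ x i, N.eval a x i = f (WithLp.toLp 2 (x + u)) i + v i := by
  classical
  obtain ⟨hfc, s, hs, hfs⟩ := hf
  have h : ∀ i, (fun x : Fin n → ℝ => f (WithLp.toLp 2 (x + u)) i + v i) ∈ netFunSet a n := by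
    intro i
    refine mem_netFunSet_of_pieces ha ?_
      (hs.toFinset.image fun A x => A (WithLp.toLp 2 (x + u)) i + v i) ?_ fun x => ?_
    · have h1 : Continuous fun x : Fin n → ℝ => f (WithLp.toLp 2 (x + u)) :=
        hfc.comp ((PiLp.continuous_toLp 2 _).comp (continuous_add_const u))
      exact (((continuous_apply i).comp (PiLp.continuous_ofLp 2 _)).comp h1).add continuous_const
    · intro B hB
      obtain ⟨A, -, rfl⟩ := Finset.mem_image.mp hB
      refine ⟨fun j => A.linear (WithLp.toLp 2 (Pi.single j 1)) i,
        A (WithLp.toLp 2 u) i + v i, fun x => ?_⟩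
      have h1 : A (WithLp.toLp 2 (x + u)) = A.linear (WithLp.toLp 2 x) + A (WithLp.toLp 2 u) := by
        rw [WithLp.toLp_add, ← vadd_eq_add, A.map_vadd, vadd_eq_add]
      have h2 : WithLp.toLp 2 x = ∑ j, x j • WithLp.toLp 2 (Pi.single j (1 : ℝ)) := by
        ext l
        simp [Pi.single_apply]
      have h3 : A.linear (WithLp.toLp 2 x) i
          = ∑ j, x j * A.linear (WithLp.toLp 2 (Pi.single j 1)) i := by
        rw [h2, map_sum]
        simp
      change A (WithLp.toLp 2 (x + u)) i + v i = _
      rw [h1, PiLp.add_apply, h3]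
      simp only [dotProduct, mul_comm]
      ring
    · obtain ⟨A, hA, h1⟩ := hfs (WithLp.toLp 2 (x + u))
      exact ⟨_, Finset.mem_image_of_mem _ (hs.mem_toFinset.mpr hA), by simp only [h1]⟩
  choose M hM using h
  obtain ⟨N, hN⟩ := exists_net_of_mem_netFun (Finset.univ.sup M) _ fun i =>
    netFun_mono ha (Finset.le_sup (Finset.mem_univ i)) (hM i)
  exact ⟨_, N, hN⟩

/-- The cost of the identity is at most `k L + O(1)`, where `k` is its bottleneck rank. -/
lemma exists_net_of_isBottleneckRank (ha : -1 < a ∧ a < 1) {Ω : Set (EuclideanSpace ℝ (Fin d))}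
    (hbdd : Bornology.IsBounded Ω)
    (hBN : IsBottleneckRank (id : EuclideanSpace ℝ (Fin d) → EuclideanSpace ℝ (Fin d)) Ω k) :
    ∃ (C : ℝ) (L₀ : ℕ), ∀ L ≥ L₀, ∃ N : Net d L d, N.IsIdOn a Ω ∧ N.normSq ≤ L * k + C := by
  obtain ⟨g, h, hg, hh, hgh⟩ := hBN.1
  obtain ⟨K, hK⟩ : ∃ K : ℝ, ∀ x ∈ Ω, ‖g x‖ ≤ K := by
    obtain ⟨K, hK⟩ := (hbdd.isCompact_closure.image hg.1).isBounded.exists_norm_le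
    exact ⟨K, fun x hx => hK _ ⟨x, subset_closure hx, rfl⟩⟩
  -- Shifting the bottleneck by `K` makes it nonnegative on `Ω`, so identity layers of cost `k`
  -- preserve it; the second network undoes the shift.
  obtain ⟨L₁, N₁, hN₁⟩ := hg.exists_net ha 0 fun _ => K
  obtain ⟨L₂, N₂, hN₂⟩ := hh.exists_net ha (fun _ => -K) 0
  refine ⟨N₁.normSq + N₂.normSq, (L₁ + 1) + (L₂ + 1), fun L hL => ?_⟩
  obtain ⟨l, rfl⟩ : ∃ l, L = (L₁ + 1 + l) + (L₂ + 1) := ⟨L - (L₁ + 1 + (L₂ + 1)), by omega⟩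
  have hpos : ∀ x ∈ Ω, ∀ i, 0 ≤ N₁.eval a x.ofLp i := by
    intro x hx i
    rw [hN₁]
    have h1 : ‖g x i‖ ≤ K := (PiLp.norm_apply_le _ i).trans (hK x hx)
    have h2 := neg_le_of_abs_le h1
    simp only [add_zero, WithLp.toLp_ofLp]
    linarith
  refine ⟨(N₁.pad l).comp N₂, fun x hx i => ?_, ?_⟩
  · rw [Net.comp_eval, N₁.pad_eval (hpos x hx)]
    have h1 : (fun i => sigma a (N₁.eval a x.ofLp i)) = (g x).ofLp + fun _ => K := by
      ext i
      rw [sigma_of_nonneg (hpos x hx i), hN₁]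
      simp
    have h2 : ((g x).ofLp + fun _ => K) + (fun _ => -K) = (g x).ofLp := by ext i; simp
    rw [h1, hN₂, h2]
    simpa using congrArg (fun y : EuclideanSpace ℝ (Fin d) => y i) (hgh x hx).symm
  · rw [Net.comp_normSq, Net.pad_normSq]
    push_cast
    nlinarith [Nat.cast_nonneg (α := ℝ) L₁, Nat.cast_nonneg (α := ℝ) L₂,
      Nat.cast_nonneg (α := ℝ) k, mul_nonneg (Nat.cast_nonneg (α := ℝ) L₁)
      (Nat.cast_nonneg (α := ℝ) k), mul_nonneg (Nat.cast_nonneg (α := ℝ) L₂)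
      (Nat.cast_nonneg (α := ℝ) k)]

lemma repCost_id_le {Ω : Set (EuclideanSpace ℝ (Fin d))} {L : ℕ} {N : Net d L d}
    (hN : N.IsIdOn a Ω) {c : ℝ} (hc : N.normSq ≤ c) :
    repCost a (id : EuclideanSpace ℝ (Fin d) → EuclideanSpace ℝ (Fin d)) Ω L ≤ ENNReal.ofReal c :=
  (iInf₂_le N hN).trans (ENNReal.ofReal_le_ofReal hc)

lemma tendsto_ofReal_div {C : ℝ} :
    Tendsto (fun L : ℕ => ENNReal.ofReal (L * k + C) / (L : ℝ≥0∞)) atTop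
      (𝓝 ((k : ℝ≥0) : ℝ≥0∞)) := by
  have h1 : Tendsto (fun L : ℕ => (k : ℝ) + C / L) atTop (𝓝 ((k : ℝ) + 0)) :=
    tendsto_const_nhds.add (tendsto_const_div_atTop_nhds_zero_nat C)
  rw [add_zero] at h1
  have h2 := (ENNReal.continuous_ofReal.tendsto _).comp h1
  rw [ENNReal.ofReal_natCast] at h2
  rw [ENNReal.coe_natCast]
  refine h2.congr' ?_
  filter_upwards [eventually_gt_atTop 0] with L hL
  have hL' : (0 : ℝ) < L := by exact_mod_cast hL
  rw [Function.comp, ← ENNReal.ofReal_natCast L, ← ENNReal.ofReal_div_of_pos hL']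
  congr 1
  field_simp

end

end DeepNet

end

/-! ### The characterization of zero first correction. -/

theorem mainTheorem8 (a : ℝ) (ha : -1 < a ∧ a < 1) (d k : ℕ)
    (Ω : Set (EuclideanSpace ℝ (Fin d))) (hbdd : Bornology.IsBounded Ω)
    (hJ : DeepNet.IsJacobianRank (id : EuclideanSpace ℝ (Fin d) → EuclideanSpace ℝ (Fin d)) Ω k)
    (hBN : DeepNet.IsBottleneckRank
      (id : EuclideanSpace ℝ (Fin d) → EuclideanSpace ℝ (Fin d)) Ω k)
    (hdense : Ω ⊆ closure {x : EuclideanSpace ℝ (Fin d) | x ∈ Ω ∧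
      ∃ T : Submodule ℝ (EuclideanSpace ℝ (Fin d)),
        DeepNet.HasTangentSpace Ω x T ∧ Module.finrank ℝ T = k}) :
    DeepNet.HasFirstCorrection a
        (id : EuclideanSpace ℝ (Fin d) → EuclideanSpace ℝ (Fin d)) Ω 0 ↔
      DeepNet.IsPlanar Ω k ∧ DeepNet.IsCompletelyPositive Ω := by
  have hne : Ω.Nonempty := by
    obtain ⟨x, hx, -⟩ := hJ.1
    exact ⟨x, hx⟩
  obtain ⟨x₀, hx₀, T₀, hT₀, hk₀⟩ := closure_nonempty_iff.mp (hne.mono hdense)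
  have hlow := DeepNet.le_repCost_id ha hx₀ hT₀ hk₀
  have hlead : DeepNet.HasLeadingTerm a (id : EuclideanSpace ℝ (Fin d) → EuclideanSpace ℝ (Fin d)) Ω k := by
    obtain ⟨C, L₀, hC⟩ := DeepNet.exists_net_of_isBottleneckRank ha hbdd hBN
    refine tendsto_of_tendsto_of_tendsto_of_le_of_le' (DeepNet.tendsto_ofReal_div (C := 0))
      (DeepNet.tendsto_ofReal_div (C := C)) ?_ ?_
    · exact Eventually.of_forall fun L => ENNReal.div_le_div_right (by simpa using hlow L) _
    · filter_upwards [eventually_ge_atTop L₀] with L hL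
      obtain ⟨N, hN, hcost⟩ := hC L hL
      exact ENNReal.div_le_div_right (DeepNet.repCost_id_le hN hcost) _
  constructor
  · rintro ⟨r₀, hr₀, hlim⟩
    -- Uniqueness of limits identifies the subtracted term as `k L`, so a zero correction gives
    -- costs close to `k L`.
    have hr : r₀ = k := ENNReal.coe_injective (tendsto_nhds_unique hr₀ hlead)
    subst hr
    refine DeepNet.planar_and_completelyPositive_of_small_cost ha hbdd hne hdense fun ε hε => ?_
    have hev : ∀ᶠ L : ℕ in atTop, (DeepNet.repCost a (id : EuclideanSpace ℝ (Fin d) → _) Ω L : EReal)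
        - (((L : ℝ) * ((k : ℝ≥0) : ℝ) : ℝ) : EReal) < (ε : EReal) :=
      hlim.eventually_lt_const (by exact_mod_cast hε)
    obtain ⟨L, hL, hL2⟩ := (hev.and (eventually_ge_atTop 2)).exists
    have h1 : DeepNet.repCost a (id : EuclideanSpace ℝ (Fin d) → _) Ω L < ENNReal.ofReal (L * k + ε) := by
      rw [EReal.sub_lt_iff (.inl (EReal.coe_ne_bot _)) (.inl (EReal.coe_ne_top _))] at hL
      rw [← EReal.coe_ennreal_lt_coe_ennreal_iff, EReal.coe_ennreal_ofReal,
        max_eq_left (by positivity)]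
      refine hL.trans_eq ?_
      push_cast
      rw [add_comm]
    simp only [DeepNet.repCost, iInf_lt_iff] at h1
    obtain ⟨N, hN, hcost⟩ := h1
    refine ⟨L, N, hL2, hN, ?_⟩
    by_contra! hcon
    exact absurd hcost (not_lt.mpr (ENNReal.ofReal_le_ofReal hcon.le))
  · rintro ⟨hpl, hcp⟩
    refine ⟨k, hlead, tendsto_const_nhds.congr' ?_⟩
    filter_upwards [eventually_ge_atTop 2] with L hL
    obtain ⟨l, rfl⟩ : ∃ l, L = l + 2 := ⟨L - 2, by omega⟩
    obtain ⟨N, hN, hcost⟩ := DeepNet.exists_net_of_planar_of_completelyPositive (a := a) hpl hcp l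
    -- The cost is exactly `k L` from depth `2` on, so the correction sequence is eventually
    -- constant.
    have h1 := le_antisymm (DeepNet.repCost_id_le hN hcost.le) (hlow _)
    rw [h1, EReal.coe_ennreal_ofReal, max_eq_left (by positivity), ← EReal.coe_sub]
    simp
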